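/- Let $\mathbb S^1=[-\pi,\pi]$ with periodic boundary conditions, $\hat f(k)=\frac1{2\pi}\int_{\mathbb S^1}f(x)e^{-ikx}\,dx$, and let $\mathcal H,\Lambda,\Lambda^{-1},\mathcal N$ be the Fourier multipliers $$\widehat{\mathcal Hf}(k)=-i\,\mathrm{sgn}(k)\hat f(k),\quad \widehat{\Lambda f}(k)=|k|\hat f(k),\quad \widehat{\Lambda^{-1}f}(k)=|k|^{-1}\hat f(k)\ (k\ne0),\ \widehat{\Lambda^{-1}f}(0)=0,\quad \widehat{\mathcal Nf}(k)=\frac{1-\delta ik}{1+\delta^2k^2}\hat f(k).$$ Put $[A,f]g=A(fg)-f(Ag)$, $\|f\|_{H^s}^2=\sum_k(1+k^2)^s|\hat f(k)|^2$, $\|f\|_{A^0}=\sum_k|\hat f(k)|$. For $\varepsilon>0$, $\delta>0$, $\beta\ge0$ consider, for real-valued zero-mean functions $u(x,t)$, the equation $$2\varepsilon u_t=\mathcal Nu_x+2\delta\mathcal Nu_{xx}+\mathcal N\mathcal Hu-\beta\mathcal N\mathcal H\partial_x^2u+\delta^2\mathcal N\partial_x^3u-\varepsilon\mathcal N\Big\{2uu_x+\Lambda[\mathcal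 H,\Lambda^{-1}u]u+\beta\Lambda[\mathcal H,\Lambda^{-1}u]\Lambda^2u-\delta\Lambda[\mathcal H,u]u_x+\delta\partial_x(uu_x)+\delta\Lambda[\partial_x^2,\Lambda^{-1}u]u\Big\}.\qquad(\ast)$$ A strong solution of $(\ast)$ on $I=[0,T]$ or $I=[0,\infty)$ is a function $u\in C(I;H^2)\cap L^2(I;H^3)$, with real-valued zero-mean values, that is differentiable in time with values in $L^2$ and satisfies $(\ast)$ at every $t\in I$. There are a constant $C>0$ and a function $(\delta,r)\mapsto\gamma(\delta,r)>0$ (for $\delta>0$, $r\in[0,2)$) such that for all $\varepsilon>0$, $\delta>0$, $\beta\ge0$ the following holds. (1) For every $R$ there is $T^*>0$, depending only on $R,\varepsilon,\delta,\beta$, such that for every real-valued zero-mean $u_0\in H^2$ with $\|u_0\|_{H^2}\le R$ there is a unique strong solution $u\in C([0,T^*];H^2)\cap L^2(0,T^*;H^3)$ of $(\ast)$ with $u(0)=u_0$. (2) There is $c_0>0$, depending only on $\varepsilon,\delta,\beta$, such that for every real-valued zero-mean $u_0\in H^2$ with $\|u_0\|_{H^2}\le c_0$ there is a unique global strong solution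 $u\in C(\mathbb R_+;H^2)\cap L^2(\mathbb R_+;H^3)$ of $(\ast)$ with $u(0)=u_0$; moreover, for all $t\ge0$, $$\|u(t)\|_{A^0}\le Ce^{-\frac{\delta}{2\varepsilon}t},\qquad \|u(t)\|_{H^r}\le Ce^{-\frac{\gamma(\delta,r)}{\varepsilon}t}\quad\text{for all } r\in[0,2).$$ In particular, for $0<\varepsilon\le1$, $\|u(t)\|_{A^0}\le Ce^{-\frac{\delta}{2}t}$ and $\|u(t)\|_{H^r}\le Ce^{-\gamma(\delta,r)t}$. -/

import Mathlib

open MeasureTheory AddCircle Filter Topology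
open scoped ENNReal

noncomputable section

namespace ViscousWave

/-- The period `2π` is positive (needed for the Fourier theory on the circle). -/
instance twoPiPos : Fact (0 < 2 * Real.pi) := Fact.mk Real.two_pi_pos

/-- The circle `𝕊¹`, i.e. `[-π, π]` with periodic boundary conditions. -/
abbrev Circ : Type := AddCircle (2 * Real.pi)

/-- Complex `L²` functions on the circle (normalized Haar measure). -/
abbrev L2C : Type := Lp ℂ 2 (haarAddCircle : Measure Circ)

/-- Periodic distributions, given by their sequence of Fourier coefficients
(with respect to the exponentials `x ↦ exp (i k x)`). -/
abbrev FSeq : Type := ℤ → ℂ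

/-- The Fourier coefficients `k ↦ (2π)⁻¹ ∫ f(x) exp (-i k x) dx` of an `L²` function. -/
def hat (f : L2C) : FSeq := fun k => fourierCoeff (f : Circ → ℂ) k

/-! ### Fourier multipliers -/

/-- The derivative `∂ₓ`, with symbol `i k`. -/
def dx (a : FSeq) : FSeq := fun k => Complex.I * (k : ℂ) * a k

/-- The Hilbert transform `H`, with symbol `-i sgn k`. -/
def hilb (a : FSeq) : FSeq := fun k => -Complex.I * ((Int.sign k : ℤ) : ℂ) * a k

/-- The operator `Λ`, with symbol `|k|`. -/
def Lam (a : FSeq) : FSeq := fun k => ((|k| : ℤ) : ℂ) * a k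

/-- The operator `Λ⁻¹`, with symbol `1 / |k|` for `k ≠ 0`; it is applied to distributions
of zero mean only, and its result has zero mean. -/
def LamInv (a : FSeq) : FSeq := fun k => if k = 0 then 0 else a k / ((|k| : ℤ) : ℂ)

/-- The operator `N = (1 - δ² ∂ₓ²)⁻¹ (1 - δ ∂ₓ)`, with symbol `(1 - δ i k) / (1 + δ² k²)`. -/
def opN (δ : ℝ) (a : FSeq) : FSeq := fun k =>
  (1 - (δ : ℂ) * Complex.I * (k : ℂ)) / (1 + (δ : ℂ) ^ 2 * (k : ℂ) ^ 2) * a k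

/-! ### Products and commutators -/

/-- The Fourier coefficients of a product: convolution (see `hat_mul`). -/
def conv (a b : FSeq) : FSeq := fun k => ∑' n : ℤ, a n * b (k - n)

/-- The Fourier coefficients of the pointwise product of two `L²` functions are given
by `conv`. -/
theorem hat_mul (f g : L2C) (k : ℤ) :
    fourierCoeff (fun x : Circ => (f : Circ → ℂ) x * (g : Circ → ℂ) x) k
      = conv (hat f) (hat g) k := by
  have hconjmul : MemLp (fun x : Circ => fourier k x * star ((f : Circ → ℂ) x)) 2
      (haarAddCircle : Measure Circ) := by
    refine (Lp.memLp f).star.of_le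
      (((map_continuous (fourier k)).aestronglyMeasurable).mul (Lp.memLp f).star.1) ?_
    refine Eventually.of_forall fun x => ?_
    rw [norm_mul, fourier_apply, Circle.norm_coe, one_mul]
    exact le_rfl
  have key := (fourierBasis (T := 2 * Real.pi)).tsum_inner_mul_inner (hconjmul.toLp _) g
  have hL : ∀ i : ℤ, inner ℂ (hconjmul.toLp _) (fourierBasis (T := 2 * Real.pi) i)
      = hat f (k - i) := by
    intro i
    rw [L2.inner_def, hat, fourierCoeff, coe_fourierBasis]
    refine integral_congr_ae ?_
    filter_upwards [hconjmul.coeFn_toLp, coeFn_fourierLp (T := 2 * Real.pi) 2 i] with x h1 h2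
    rw [h1, h2]
    have h3 : fourier (-(k - i)) x = star (fourier k x) * fourier i x := by
      rw [show -(k - i) = -k + i by ring, fourier_add, fourier_neg]; rfl
    rw [h3, RCLike.inner_apply, smul_eq_mul]
    simp
    ring
  have hR : ∀ i : ℤ, inner ℂ (fourierBasis (T := 2 * Real.pi) i) g = hat g i := by
    intro i
    rw [← HilbertBasis.repr_apply_apply, fourierBasis_repr]
    rfl
  have hI : inner ℂ (hconjmul.toLp _) g
      = fourierCoeff (fun x : Circ => (f : Circ → ℂ) x * (g : Circ → ℂ) x) k := by
    rw [L2.inner_def, fourierCoeff]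
    refine integral_congr_ae ?_
    filter_upwards [hconjmul.coeFn_toLp] with x h1
    rw [h1, fourier_neg, RCLike.inner_apply, smul_eq_mul]
    simp
    ring
  rw [← hI, ← key, conv, ← (Equiv.subLeft k).tsum_eq]
  refine tsum_congr fun i => ?_
  rw [hL, hR]
  simp [Equiv.subLeft]

/-- The commutator `[A, f] g = A (f g) - f (A g)` of an operator `A` with the multiplication
by `f`. -/
def comm (A : FSeq → FSeq) (f g : FSeq) : FSeq := A (conv f g) - conv f (A g)

/-! ### The equation -/

/-- The nonlinearity
`2 u uₓ + Λ [H, Λ⁻¹u] u + β Λ [H, Λ⁻¹u] Λ² u - δ Λ [H, u] uₓ + δ ∂ₓ (u uₓ) + δ Λ [∂ₓ², Λ⁻¹u] u`. -/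
def nonlin (δ β : ℝ) (u : FSeq) : FSeq :=
  (2 : ℂ) • conv u (dx u)
    + Lam (comm hilb (LamInv u) u)
    + (β : ℂ) • Lam (comm hilb (LamInv u) (Lam (Lam u)))
    - (δ : ℂ) • Lam (comm hilb u (dx u))
    + (δ : ℂ) • dx (conv u (dx u))
    + (δ : ℂ) • Lam (comm (fun a => dx (dx a)) (LamInv u) u)

/-- The right-hand side
`N uₓ + 2 δ N uₓₓ + N H u - β N H ∂ₓ² u + δ² N ∂ₓ³ u - ε N {nonlinearity}`
of the equation for `2 ε uₜ`. -/
def rhs (ε δ β : ℝ) (u : FSeq) : FSeq :=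
  opN δ (dx u)
    + (2 * δ : ℂ) • opN δ (dx (dx u))
    + opN δ (hilb u)
    - (β : ℂ) • opN δ (hilb (dx (dx u)))
    + ((δ : ℂ) ^ 2) • opN δ (dx (dx (dx u)))
    - (ε : ℂ) • opN δ (nonlin δ β u)

/-! ### Norms -/

/-- The norm of `H^s`, `(∑ (1 + k²)^s |û(k)|²)^(1/2)`; it is `∞` if and only if `f ∉ H^s`. -/
def sobolevNorm (s : ℝ) (f : L2C) : ℝ≥0∞ :=
  (∑' k : ℤ, ENNReal.ofReal ((1 + (k : ℝ) ^ 2) ^ s * ‖hat f k‖ ^ 2)) ^ (1 / 2 : ℝ)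

/-- The norm of the Wiener space `A⁰`, `∑ |û(k)|`; it is `∞` if and only if `f ∉ A⁰`. -/
def wienerNorm (f : L2C) : ℝ≥0∞ := ∑' k : ℤ, ENNReal.ofReal ‖hat f k‖

/-- `f` is a real-valued function of zero mean. -/
def RealZeroMean (f : L2C) : Prop :=
  (∀ᵐ x ∂(haarAddCircle : Measure Circ), ((f : Circ → ℂ) x).im = 0) ∧
    ∫ x, (f : Circ → ℂ) x ∂(haarAddCircle : Measure Circ) = 0

/-- `u` is a strong solution of the equation on the time interval `I` (which contains `0`)
with initial datum `u₀`, of class `C(I; H²) ∩ L²(I; H³)`: the values are real zero-mean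
functions, and `u` is differentiable in time with values in `L²`, its derivative satisfying
the equation at every time of `I`. -/
structure IsStrongSolution (ε δ β : ℝ) (I : Set ℝ) (u₀ : L2C) (u : ℝ → L2C) : Prop where
  initial : u 0 = u₀
  realZeroMean : ∀ t ∈ I, RealZeroMean (u t)
  mem_H2 : ∀ t ∈ I, sobolevNorm 2 (u t) < ∞
  continuous_H2 : ∀ t ∈ I, Tendsto (fun τ => sobolevNorm 2 (u τ - u t)) (𝓝[I] t) (𝓝 0)
  sq_integrable_H3 : ∫⁻ t in I, sobolevNorm 3 (u t) ^ 2 < ∞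
  equation : ∀ t ∈ I, ∃ v : L2C, HasDerivWithinAt u v I t ∧
    (2 * ε : ℂ) • hat v = rhs ε δ β (hat (u t))

end ViscousWave

end

noncomputable section

namespace ViscousWave

/-! ### Weights and convolution inequalities on `ℤ` -/

/-! The equation is parabolic in disguise. Since `N = (1 + δ∂ₓ)⁻¹` and `∂ₓ + 2δ∂ₓ² + δ²∂ₓ³ = ∂ₓ(1 +
δ∂ₓ)²`, the differential part of the linear operator collapses to `∂ₓ + δ∂ₓ²`. The Hilbert terms
only add damping. Mode by mode, `u_k' = -μ_k u_k + ∑ S(k,n) u_n u_{k-n}`, where `Re μ_k` exceeds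
`δ/(2ε)` for `k ≠ 0` by at least a multiple of `1 + k²` (`gap_le_re_linsym`). The commutators cancel
the singular or high-order parts of the nonlinearity and `N` gains one derivative, so `S` loses only
one derivative (`norm_bilsym_le`).

The mild formulation is solved for `v_k = e^{at}(1 + k²)u_k` in `ℓ²(ℤ; C_b(ℝ))`, with the supremum
in time taken inside the sum over modes. There the Duhamel integral is estimated separately for each
`k`: the heat kernel recovers the lost derivative at the price of a constant `κ`, and Young's
inequality controls the convolution (`wconv_bound`, `norm_bilin_le`). A quadratic contraction
(`exists_quadratic_fixedPoint`) then gives a solution whenever the datum is small compared with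
`1/κ`. On `[0,T]` with `a = 0` one has `κ ~ √T`, so a short time suffices for any datum. On `[0,∞)`
with `a = δ/(2ε)` the constant `κ` is fixed, the datum must be small, and the weight `e^{at}` is the
decay, already in `H²`; no interpolation is needed.

The majorant of the modes, uniform in time, gives continuity in `H²` and differentiability in `L²`
by dominated convergence, and a second kernel bound gives `L²(H³)`. Uniqueness is an `L²` energy
estimate (`energy_le`) followed by Gronwall: the lost derivative either falls on a solution, which
is in `H²`, or on the output frequency, where the damping absorbs it. -/

/-- The weight `1 + k²`. -/
def wt (k : ℤ) : ℝ := 1 + (k : ℝ) ^ 2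

/-- The weight `1 + |k|`. -/
def br (k : ℤ) : ℝ := 1 + |(k : ℝ)|

lemma one_le_wt (k : ℤ) : 1 ≤ wt k := by unfold wt; nlinarith [sq_nonneg (k : ℝ)]

lemma wt_pos (k : ℤ) : 0 < wt k := zero_lt_one.trans_le (one_le_wt k)

lemma one_le_br (k : ℤ) : 1 ≤ br k := by unfold br; linarith [abs_nonneg (k : ℝ)]

lemma br_pos (k : ℤ) : 0 < br k := zero_lt_one.trans_le (one_le_br k)

lemma wt_neg (k : ℤ) : wt (-k) = wt k := by simp [wt]

lemma wt_le_br_sq (k : ℤ) : wt k ≤ br k ^ 2 := by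
  unfold wt br; nlinarith [abs_nonneg (k : ℝ), sq_abs (k : ℝ)]

lemma br_sq_le (k : ℤ) : br k ^ 2 ≤ 2 * wt k := by
  unfold wt br; nlinarith [sq_nonneg (|(k : ℝ)| - 1), sq_abs (k : ℝ)]

lemma br_le_wt (k : ℤ) : br k ≤ 2 * wt k := by
  nlinarith [br_sq_le k, one_le_br k]

lemma br_le_add (k n : ℤ) : br k ≤ br n + br (k - n) := by
  unfold br
  have := abs_add_le (n : ℝ) ((k : ℝ) - n)
  push_cast
  rw [add_sub_cancel] at this
  linarith

lemma summable_inv_wt : Summable fun k : ℤ => 1 / wt k := by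
  have h : Summable fun k : ℤ => 1 / (k : ℝ) ^ 2 :=
    Real.summable_one_div_int_pow.mpr one_lt_two
  refine Summable.of_norm_bounded_eventually h ?_
  have hf : ∀ᶠ k : ℤ in cofinite, k ≠ 0 := by
    simpa using (Set.finite_singleton (0 : ℤ)).compl_mem_cofinite
  filter_upwards [hf] with k hk
  have hk' : (0 : ℝ) < (k : ℝ) ^ 2 := by positivity
  rw [Real.norm_of_nonneg (by have := wt_pos k; positivity)]
  exact one_div_le_one_div_of_le hk' (by unfold wt; linarith)

lemma summable_inv_wt_sq : Summable fun k : ℤ => (1 / wt k) ^ 2 := by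
  refine summable_inv_wt.of_nonneg_of_le (fun k => sq_nonneg _) fun k => ?_
  have h1 : 1 / wt k ≤ 1 := by rw [div_le_one (wt_pos k)]; exact one_le_wt k
  have h0 : 0 ≤ 1 / wt k := by have := wt_pos k; positivity
  nlinarith

lemma summable_mul_of_sq {ι : Type*} {x y : ι → ℝ} (hx : Summable fun i => x i ^ 2)
    (hy : Summable fun i => y i ^ 2) : Summable fun i => x i * y i := by
  refine Summable.of_norm_bounded (hx.add hy) fun i => ?_
  rw [norm_mul, Real.norm_eq_abs, Real.norm_eq_abs]
  nlinarith [sq_nonneg (|x i| - |y i|), sq_abs (x i), sq_abs (y i), sq_nonneg (x i),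
    sq_nonneg (y i)]

lemma tsum_mul_sq_le {ι : Type*} {x y : ι → ℝ} (hx : Summable fun i => x i ^ 2)
    (hy : Summable fun i => y i ^ 2) :
    (∑' i, x i * y i) ^ 2 ≤ (∑' i, x i ^ 2) * ∑' i, y i ^ 2 := by
  have hxy := summable_mul_of_sq hx hy
  have key : ∀ t : ℝ, 0 ≤ (∑' i, y i ^ 2) * (t * t) + (2 * ∑' i, x i * y i) * t
      + ∑' i, x i ^ 2 := by
    intro t
    have h : ∑' i, (x i + t * y i) ^ 2
        = (∑' i, y i ^ 2) * (t * t) + (2 * ∑' i, x i * y i) * t + ∑' i, x i ^ 2 := by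
      rw [← tsum_mul_left, ← tsum_mul_right, ← tsum_mul_right,
        ← ((hy.mul_right _)).tsum_add ((hxy.mul_left 2).mul_right t),
        ← ((hy.mul_right _).add ((hxy.mul_left 2).mul_right t)).tsum_add hx]
      exact tsum_congr fun i => by ring
    rw [← h]
    exact tsum_nonneg fun i => sq_nonneg _
  have := discrim_le_zero key
  unfold discrim at this
  nlinarith

/-- Young's inequality `ℓ² * ℓ¹ ⊂ ℓ²`. -/
lemma young_l2_l1 {x y : ℤ → ℝ} (hx : Summable fun n => x n ^ 2) (hy : Summable y)
    (hy0 : ∀ n, 0 ≤ y n) :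
    (∀ k, Summable fun n => x n * y (k - n)) ∧
    (Summable fun k => (∑' n, x n * y (k - n)) ^ 2) ∧
    ∑' k, (∑' n, x n * y (k - n)) ^ 2 ≤ (∑' n, y n) ^ 2 * ∑' n, x n ^ 2 := by
  have hshift : ∀ k, Summable fun n => y (k - n) := fun k =>
    (Equiv.subLeft k).summable_iff.mpr hy
  have hprod : Summable fun z : ℤ × ℤ => x z.1 ^ 2 * y z.2 :=
    hx.mul_of_nonneg hy (fun n => sq_nonneg _) hy0
  -- The shear `(k, n) ↦ (n, k - n)` turns the double sum of the convolution into a product of two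
  -- sums.
  let e : ℤ × ℤ ≃ ℤ × ℤ :=
    { toFun := fun z => (z.2, z.1 - z.2)
      invFun := fun z => (z.1 + z.2, z.1)
      left_inv := fun z => by ext <;> simp
      right_inv := fun z => by ext <;> simp }
  have hprod' : Summable fun z : ℤ × ℤ => x z.2 ^ 2 * y (z.1 - z.2) :=
    e.summable_iff.mpr hprod
  have hk : ∀ k, Summable fun n => x n ^ 2 * y (k - n) := fun k => hprod'.prod_factor k
  have hroot : ∀ k n, (x n * √(y (k - n))) ^ 2 = x n ^ 2 * y (k - n) := fun k n => by
    rw [mul_pow, Real.sq_sqrt (hy0 _)]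
  have hroot' : ∀ k n, √(y (k - n)) ^ 2 = y (k - n) := fun k n => Real.sq_sqrt (hy0 _)
  have hmul : ∀ k n, (x n * √(y (k - n))) * √(y (k - n)) = x n * y (k - n) := fun k n => by
    rw [mul_assoc, Real.mul_self_sqrt (hy0 _)]
  have h1 : ∀ k, Summable fun n => x n * y (k - n) := fun k => by
    refine (summable_mul_of_sq (x := fun n => x n * √(y (k - n)))
      (y := fun n => √(y (k - n))) ?_ ?_).congr (hmul k)
    · exact (hk k).congr fun n => (hroot k n).symm
    · exact (hshift k).congr fun n => (hroot' k n).symm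
  -- Cauchy–Schwarz after splitting `y = √y · √y`; this is where the `ℓ¹` norm of `y` comes out.
  have h2 : ∀ k, (∑' n, x n * y (k - n)) ^ 2 ≤ (∑' n, x n ^ 2 * y (k - n)) * ∑' n, y n := by
    intro k
    have h := tsum_mul_sq_le (x := fun n => x n * √(y (k - n)))
      (y := fun n => √(y (k - n))) ((hk k).congr fun n => (hroot k n).symm)
      ((hshift k).congr fun n => (hroot' k n).symm)
    simp only [hroot, hroot', hmul] at h
    have hs : ∑' n, y (k - n) = ∑' n, y n := (Equiv.subLeft k).tsum_eq y
    rwa [hs] at h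
  have h3 : Summable fun k => (∑' n, x n ^ 2 * y (k - n)) * ∑' n, y n :=
    hprod'.prod.mul_right _
  have h4 : Summable fun k => (∑' n, x n * y (k - n)) ^ 2 :=
    h3.of_nonneg_of_le (fun k => sq_nonneg _) h2
  refine ⟨h1, h4, (h4.tsum_le_tsum h2 h3).trans (le_of_eq ?_)⟩
  rw [tsum_mul_right, ← hprod'.tsum_prod' hk,
    show ∑' z : ℤ × ℤ, x z.2 ^ 2 * y (z.1 - z.2) = ∑' z : ℤ × ℤ, x z.1 ^ 2 * y z.2 from
      e.tsum_eq fun z : ℤ × ℤ => x z.1 ^ 2 * y z.2,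
    ← hx.tsum_mul_tsum hy hprod]
  ring

/-- The convolution `∑ (1 / wt n + 1 / wt (k - n)) x n y (k - n)`. -/
def wconv (x y : ℤ → ℝ) (k : ℤ) : ℝ :=
  ∑' n, (1 / wt n + 1 / wt (k - n)) * (x n * y (k - n))

lemma summable_div_wt {x : ℤ → ℝ} (hx : Summable fun n => x n ^ 2) :
    Summable fun n => x n / wt n :=
  (summable_mul_of_sq hx summable_inv_wt_sq).congr fun n => by ring

lemma tsum_div_wt_sq_le {x : ℤ → ℝ} (hx : Summable fun n => x n ^ 2) :
    (∑' n, x n / wt n) ^ 2 ≤ (∑' n, x n ^ 2) * ∑' n, (1 / wt n) ^ 2 := by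
  have h := tsum_mul_sq_le hx summable_inv_wt_sq
  simpa only [mul_one_div] using h

/-- In each half of the weight, the factor divided by `wt` is in `ℓ¹` by Cauchy–Schwarz, so Young's
inequality applies with the other factor in `ℓ²`. The constant `4` is `2 + 2`, from `(p + q)² ≤ 2p²
+ 2q²`. -/
lemma wconv_bound {x y : ℤ → ℝ} (hx : Summable fun n => x n ^ 2) (hy : Summable fun n => y n ^ 2)
    (hx0 : ∀ n, 0 ≤ x n) (hy0 : ∀ n, 0 ≤ y n) :
    (∀ k, Summable fun n => (1 / wt n + 1 / wt (k - n)) * (x n * y (k - n))) ∧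
    (Summable fun k => wconv x y k ^ 2) ∧
    ∑' k, wconv x y k ^ 2
      ≤ 4 * (∑' n, (1 / wt n) ^ 2) * ((∑' n, x n ^ 2) * ∑' n, y n ^ 2) := by
  have hxs := summable_div_wt hx
  have hys := summable_div_wt hy
  obtain ⟨a1, a2, a3⟩ := young_l2_l1 hx hys fun n => div_nonneg (hy0 n) (wt_pos n).le
  obtain ⟨b1, b2, b3⟩ := young_l2_l1 hy hxs fun n => div_nonneg (hx0 n) (wt_pos n).le
  have hflip : ∀ k, Summable fun n => y (k - n) * (x n / wt n) := fun k =>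
    ((Equiv.subLeft k).summable_iff.mpr (b1 k)).congr fun n => by simp [Equiv.subLeft]
  have hflip' : ∀ k, ∑' n, y (k - n) * (x n / wt n) = ∑' n, y n * (x (k - n) / wt (k - n)) :=
    fun k => by
      rw [← (Equiv.subLeft k).tsum_eq fun n => y n * (x (k - n) / wt (k - n))]
      exact tsum_congr fun n => by simp [Equiv.subLeft]
  have hsplit : ∀ k n, (1 / wt n + 1 / wt (k - n)) * (x n * y (k - n))
      = x n * (y (k - n) / wt (k - n)) + y (k - n) * (x n / wt n) := fun k n => by ring
  have hsum : ∀ k, Summable fun n => (1 / wt n + 1 / wt (k - n)) * (x n * y (k - n)) := fun k =>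
    ((a1 k).add (hflip k)).congr fun n => (hsplit k n).symm
  have heq : ∀ k, wconv x y k = (∑' n, x n * (y (k - n) / wt (k - n)))
      + ∑' n, y n * (x (k - n) / wt (k - n)) := fun k => by
    rw [wconv, tsum_congr (hsplit k), (a1 k).tsum_add (hflip k), hflip' k]
  have hle : ∀ k, wconv x y k ^ 2 ≤ 2 * (∑' n, x n * (y (k - n) / wt (k - n))) ^ 2
      + 2 * (∑' n, y n * (x (k - n) / wt (k - n))) ^ 2 := fun k => by
    rw [heq]
    nlinarith [sq_nonneg ((∑' n, x n * (y (k - n) / wt (k - n)))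
      - ∑' n, y n * (x (k - n) / wt (k - n)))]
  have hs2 := (a2.mul_left 2).add (b2.mul_left 2)
  have hs : Summable fun k => wconv x y k ^ 2 := hs2.of_nonneg_of_le (fun k => sq_nonneg _) hle
  refine ⟨hsum, hs, (hs.tsum_le_tsum hle hs2).trans ?_⟩
  rw [(a2.mul_left 2).tsum_add (b2.mul_left 2), tsum_mul_left, tsum_mul_left]
  have hX : 0 ≤ ∑' n, x n ^ 2 := tsum_nonneg fun n => sq_nonneg _
  have hY : 0 ≤ ∑' n, y n ^ 2 := tsum_nonneg fun n => sq_nonneg _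
  have c1 := mul_le_mul_of_nonneg_right (tsum_div_wt_sq_le hy) hX
  have c2 := mul_le_mul_of_nonneg_right (tsum_div_wt_sq_le hx) hY
  linarith

lemma wconv_nonneg {x y : ℤ → ℝ} (hx0 : ∀ n, 0 ≤ x n) (hy0 : ∀ n, 0 ≤ y n) (k : ℤ) :
    0 ≤ wconv x y k :=
  tsum_nonneg fun n => mul_nonneg (add_nonneg (one_div_nonneg.mpr (wt_pos n).le)
    (one_div_nonneg.mpr (wt_pos _).le)) (mul_nonneg (hx0 n) (hy0 _))

/-! ### Quadratic fixed-point problems -/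

/-- Banach's theorem on the ball of radius `2r`, where the map has Lipschitz constant `4Mr`.
Intersecting with an invariant closed set `D` lets the fixed point inherit a constraint; here it
will be the reality of the solution. -/
lemma exists_quadratic_fixedPoint {X : Type*} [NormedAddCommGroup X] [CompleteSpace X]
    (B : X → X → X) {M r : ℝ} (hM : 0 ≤ M)
    (hleft : ∀ v v' w, B (v - v') w = B v w - B v' w)
    (hright : ∀ v w w', B v (w - w') = B v w - B v w')
    (hbound : ∀ v w, ‖B v w‖ ≤ M * (‖v‖ * ‖w‖)) {x₀ : X} (hx₀ : ‖x₀‖ ≤ r)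
    (hMr : 4 * M * r < 1) {D : Set X} (hD : IsClosed D) (hx₀D : x₀ ∈ D)
    (hmaps : ∀ v ∈ D, x₀ + B v v ∈ D) :
    ∃ v ∈ D, ‖v‖ ≤ 2 * r ∧ v = x₀ + B v v := by
  have hr : 0 ≤ r := (norm_nonneg _).trans hx₀
  set s : Set X := Metric.closedBall 0 (2 * r) ∩ D
  have hs : IsComplete s := (Metric.isClosed_closedBall.inter hD).isComplete
  have hmem : ∀ v ∈ s, ‖v‖ ≤ 2 * r := fun v hv => by simpa using hv.1
  have hsf : Set.MapsTo (fun v => x₀ + B v v) s s := by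
    intro v hv
    refine ⟨?_, hmaps v hv.2⟩
    have h1 := hmem v hv
    have h2 : ‖v‖ * ‖v‖ ≤ 2 * r * (2 * r) := mul_le_mul h1 h1 (norm_nonneg _) (by positivity)
    have h3 := mul_le_mul_of_nonneg_left h2 hM
    rw [mem_closedBall_zero_iff]
    refine (norm_add_le _ _).trans ?_
    nlinarith [hbound v v]
  have hlip : LipschitzWith (Real.toNNReal (4 * M * r)) (hsf.restrict (fun v => x₀ + B v v)) := by
    refine LipschitzWith.of_dist_le_mul fun v w => ?_
    rw [Real.coe_toNNReal _ (by positivity), Subtype.dist_eq, Subtype.dist_eq, dist_eq_norm,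
      dist_eq_norm]
    simp only [Set.MapsTo.val_restrict_apply]
    have hsplit : x₀ + B v v - (x₀ + B w w)
        = B ((v : X) - w) v + B (w : X) ((v : X) - w) := by
      rw [hleft, hright]; abel
    rw [hsplit]
    refine (norm_add_le _ _).trans ?_
    have hv := hmem v v.2
    have hw := hmem w w.2
    have hn := norm_nonneg ((v : X) - w)
    have c1 := mul_le_mul_of_nonneg_left (mul_le_mul_of_nonneg_left hv hn) hM
    have c2 := mul_le_mul_of_nonneg_left (mul_le_mul_of_nonneg_right hw hn) hM
    nlinarith [hbound ((v : X) - w) v, hbound (w : X) ((v : X) - w)]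
  have hcontr : ContractingWith (Real.toNNReal (4 * M * r))
      (hsf.restrict (fun v => x₀ + B v v)) :=
    ⟨by rw [← NNReal.coe_lt_coe, Real.coe_toNNReal _ (by positivity)]; simpa using hMr, hlip⟩
  have hx₀s : x₀ ∈ s := ⟨by rw [mem_closedBall_zero_iff]; linarith, hx₀D⟩
  obtain ⟨v, hv, hfix, -⟩ := hcontr.exists_fixedPoint' hs hsf hx₀s (edist_ne_top _ _)
  exact ⟨v, hv.2, hmem v hv, hfix.symm⟩

/-! ### Semilinear parabolic systems for Fourier modes -/

/-- The data of a system `u_k' = -μ k u_k + ∑ n, S k n u_n u_{k-n}` with parabolic damping and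
a quadratic term losing one derivative, on the time interval `I`, with a projection `p` of
the line to `I` and a smoothing constant `κ`. -/
structure ParabolicSystem where
  μ : ℤ → ℂ
  S : ℤ → ℤ → ℂ
  a : ℝ
  η : ℝ
  K : ℝ
  L : ℝ
  κ : ℝ
  I : Set ℝ
  p : ℝ → ℝ
  a_nonneg : 0 ≤ a
  η_pos : 0 < η
  K_nonneg : 0 ≤ K
  κ_nonneg : 0 ≤ κ
  -- `a` is the decay rate to be carried by the weight `e^{at}`; `η` is the parabolic damping left
  -- after paying for it.
  re_le : ∀ k, a + η * wt k ≤ (μ k).re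
  norm_μ_le : ∀ k, ‖μ k‖ ≤ L * wt k
  norm_S_le : ∀ k n, ‖S k n‖ ≤ K * (br n + br (k - n))
  μ_neg : ∀ k, μ (-k) = star (μ k)
  S_neg : ∀ k n, S (-k) (-n) = star (S k n)
  -- The mean is preserved.
  S_zero : ∀ n, S 0 n = 0
  -- Composing with the retraction `p` makes every function of time defined, continuous and bounded
  -- on all of `ℝ`, so one function space serves for both kinds of interval.
  p_cont : Continuous p
  p_mem : ∀ t, p t ∈ I
  p_eq : ∀ t ∈ I, p t = t
  nonneg_of_mem : ∀ t ∈ I, 0 ≤ t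
  zero_mem : (0 : ℝ) ∈ I
  -- The heat kernel gains the derivative that `S` loses. The size of `κ` is what distinguishes
  -- short times from small data.
  kernel_le : ∀ k t, br k * ∫ s in (0 : ℝ)..p t, Real.exp (-(η * wt k * s)) ≤ κ

namespace ParabolicSystem

/-- Bounded continuous functions of time. -/
abbrev Cb : Type := BoundedContinuousFunction ℝ ℂ

/-- Square summable sequences of bounded continuous functions of time. -/
abbrev X : Type := lp (fun _ : ℤ => Cb) 2

variable (P : ParabolicSystem)

lemma p_nonneg (t : ℝ) : 0 ≤ P.p t := P.nonneg_of_mem _ (P.p_mem t)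

lemma rate_pos (k : ℤ) : 0 < P.η * wt k := mul_pos P.η_pos (wt_pos k)

/-- The Duhamel integral for the mode `k`, in the variable `e^{a t} u_k`. -/
def duhamel (k : ℤ) (f : Cb) (t : ℝ) : ℂ :=
  -- A product of two weighted modes carries `e^{2as}` while the equation supplies only `e^{as}`:
  -- hence `2a` inside the integral and `a` outside.
  Complex.exp (-(P.μ k - P.a) * P.p t) *
    ∫ s in (0 : ℝ)..P.p t, Complex.exp ((P.μ k - 2 * P.a) * s) * f s

lemma integrand_cont (k : ℤ) (f : Cb) :
    Continuous fun s : ℝ => Complex.exp ((P.μ k - 2 * P.a) * s) * f s := by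
  have := f.continuous
  fun_prop

lemma duhamel_cont (k : ℤ) (f : Cb) : Continuous (P.duhamel k f) := by
  have h := intervalIntegral.continuous_primitive (μ := volume)
    (fun a b => (P.integrand_cont k f).intervalIntegrable a b) 0
  have hp := P.p_cont
  have h2 := h.comp hp
  unfold duhamel
  exact (by fun_prop : Continuous fun t => Complex.exp (-(P.μ k - P.a) * P.p t)).mul h2

/-- The exponent has real part `-(Re μ - a)(t - s) - as`. The first term is controlled by the gap,
and the surplus factor `e^{-as} ≤ 1` of the quadratic term is discarded. -/
lemma norm_duhamel_le_integral (k : ℤ) (f : Cb) (t : ℝ) :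
    ‖P.duhamel k f t‖ ≤ ‖f‖ * ∫ s in (0 : ℝ)..P.p t, Real.exp (-(P.η * wt k * s)) := by
  have hp := P.p_nonneg t
  have hsub : ∫ s in (0 : ℝ)..P.p t, Real.exp (-(P.η * wt k * s))
      = ∫ s in (0 : ℝ)..P.p t, Real.exp (-(P.η * wt k * (P.p t - s))) := by
    rw [intervalIntegral.integral_comp_sub_left fun s => Real.exp (-(P.η * wt k * s))]
    simp
  rw [duhamel, hsub, ← intervalIntegral.integral_const_mul,
    ← intervalIntegral.integral_const_mul]
  refine intervalIntegral.norm_integral_le_of_norm_le hp ?_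
    (Continuous.intervalIntegrable (by fun_prop) _ _)
  refine Eventually.of_forall fun s hs => ?_
  rw [← mul_assoc, ← Complex.exp_add, norm_mul, Complex.norm_exp, mul_comm]
  refine mul_le_mul (f.norm_coe_le_norm s) (Real.exp_le_exp.mpr ?_) (Real.exp_nonneg _)
    (norm_nonneg _)
  have h1 : (-(P.μ k - P.a) * P.p t + (P.μ k - 2 * P.a) * s).re
      = -((P.μ k).re - P.a) * (P.p t - s) - P.a * s := by
    simp; ring
  rw [h1]
  have h2 := mul_le_mul_of_nonneg_right (P.re_le k) (sub_nonneg.mpr hs.2)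
  have h3 := mul_nonneg P.a_nonneg hs.1.le
  nlinarith

lemma norm_duhamel_le_κ (k : ℤ) (f : Cb) (t : ℝ) :
    br k * ‖P.duhamel k f t‖ ≤ P.κ * ‖f‖ := by
  have h1 := mul_le_mul_of_nonneg_left (P.norm_duhamel_le_integral k f t) (br_pos k).le
  have h2 := mul_le_mul_of_nonneg_left (P.kernel_le k t) (norm_nonneg f)
  linarith

lemma integral_exp_le {c : ℝ} (hc : 0 < c) (T : ℝ) :
    ∫ s in (0 : ℝ)..T, Real.exp (-(c * s)) ≤ 1 / c := by
  have h : ∀ s, HasDerivAt (fun s => -(Real.exp (-(c * s)) / c)) (Real.exp (-(c * s))) s := by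
    intro s
    have h1 : HasDerivAt (fun s => -(c * s)) (-c) s := by
      simpa using ((hasDerivAt_id s).const_mul c).fun_neg
    refine (h1.exp.div_const c).fun_neg.congr_deriv ?_
    field_simp
  rw [intervalIntegral.integral_eq_sub_of_hasDerivAt (fun s _ => h s)
    (Continuous.intervalIntegrable (by fun_prop) _ _)]
  have := Real.exp_nonneg (-(c * T))
  simp only [mul_zero, neg_zero, Real.exp_zero]
  have : 0 ≤ Real.exp (-(c * T)) / c := by positivity
  linarith

/-- Integrating the kernel over all times gains two derivatives instead of one; this is what puts
the Duhamel term in `H³`. -/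
lemma norm_duhamel_le_rate (k : ℤ) (f : Cb) (t : ℝ) :
    ‖P.duhamel k f t‖ ≤ ‖f‖ / (P.η * wt k) := by
  refine (P.norm_duhamel_le_integral k f t).trans ?_
  rw [div_eq_mul_one_div]
  exact mul_le_mul_of_nonneg_left (integral_exp_le (P.rate_pos k) _) (norm_nonneg _)

/-- The Duhamel integral as a bounded continuous function. -/
def duhamelCb (k : ℤ) (f : Cb) : Cb :=
  BoundedContinuousFunction.ofNormedAddCommGroup (P.duhamel k f) (P.duhamel_cont k f)
    (P.κ * ‖f‖ / br k) fun t => by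
      rw [le_div_iff₀ (br_pos k), mul_comm]; exact P.norm_duhamel_le_κ k f t

lemma norm_duhamelCb_le (k : ℤ) (f : Cb) : ‖P.duhamelCb k f‖ ≤ P.κ * ‖f‖ / br k :=
  BoundedContinuousFunction.norm_ofNormedAddCommGroup_le _
    (div_nonneg (mul_nonneg P.κ_nonneg (norm_nonneg f)) (br_pos k).le) _

lemma duhamelCb_sub (k : ℤ) (f g : Cb) :
    P.duhamelCb k (f - g) = P.duhamelCb k f - P.duhamelCb k g := by
  ext t
  change P.duhamel k (f - g) t = P.duhamel k f t - P.duhamel k g t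
  unfold duhamel
  rw [← mul_sub, ← intervalIntegral.integral_sub
    ((P.integrand_cont k f).intervalIntegrable _ _) ((P.integrand_cont k g).intervalIntegrable _ _)]
  simp [mul_sub]

/-! ### The quadratic term -/

/-- The weighted symbol `wt k S(k,n) / (wt n wt (k - n))`. -/
def wS (k n : ℤ) : ℂ := (wt k : ℂ) * P.S k n / ((wt n : ℂ) * (wt (k - n) : ℂ))

/-- Only one factor `br k` of the weight `wt k ≤ br k ^ 2` is left outside, for the Duhamel kernel.
The other is distributed by `br k ≤ br n + br (k - n)`, and together with the loss in `S` it costs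
at most `4 (wt n + wt (k - n))`. -/
lemma norm_wS_le (k n : ℤ) :
    ‖P.wS k n‖ ≤ 4 * P.K * br k * (1 / wt n + 1 / wt (k - n)) := by
  have hn := wt_pos n
  have hm := wt_pos (k - n)
  rw [wS, norm_div, norm_mul, norm_mul, Complex.norm_of_nonneg (wt_pos k).le,
    Complex.norm_of_nonneg hn.le, Complex.norm_of_nonneg hm.le, div_le_iff₀ (by positivity)]
  have e : 4 * P.K * br k * (1 / wt n + 1 / wt (k - n)) * (wt n * wt (k - n))
      = P.K * br k * (4 * (wt n + wt (k - n))) := by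
    field_simp
    ring
  rw [e]
  have h1 : wt k ≤ br k * (br n + br (k - n)) :=
    (wt_le_br_sq k).trans (by
      rw [sq]; exact mul_le_mul_of_nonneg_left (br_le_add k n) (br_pos k).le)
  have h2 : (br n + br (k - n)) * (br n + br (k - n)) ≤ 4 * (wt n + wt (k - n)) := by
    nlinarith [br_sq_le n, br_sq_le (k - n), sq_nonneg (br n - br (k - n))]
  calc wt k * ‖P.S k n‖
      ≤ (br k * (br n + br (k - n))) * (P.K * (br n + br (k - n))) :=
        mul_le_mul h1 (P.norm_S_le k n) (norm_nonneg _)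
          (mul_nonneg (br_pos k).le (add_nonneg (br_pos n).le (br_pos _).le))
    _ = P.K * br k * ((br n + br (k - n)) * (br n + br (k - n))) := by ring
    _ ≤ _ := mul_le_mul_of_nonneg_left h2 (mul_nonneg P.K_nonneg (br_pos k).le)

lemma summable_norm_sq (v : X) : Summable fun n => ‖v n‖ ^ 2 := by
  have := (memℓp_gen_iff (p := 2) (by norm_num)).mp (lp.memℓp v)
  simpa using this

lemma norm_sq_eq (v : X) : ‖v‖ ^ 2 = ∑' n, ‖v n‖ ^ 2 := by
  have := lp.norm_rpow_eq_tsum (p := 2) (by norm_num) v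
  simpa using this

lemma memℓp_of_summable_sq {E : Type*} [NormedAddCommGroup E] {f : ℤ → E}
    (h : Summable fun n => ‖f n‖ ^ 2) : Memℓp f 2 := by
  rw [memℓp_gen_iff (by norm_num)]
  simpa using h

/-- The quadratic term in the mode `k`. -/
def quad (v w : X) (k : ℤ) : Cb := ∑' n, P.wS k n • (v n * w (k - n))

/-- The majorant of the quadratic term. -/
def maj (v w : X) (k : ℤ) : ℝ := wconv (fun n => ‖v n‖) (fun n => ‖w n‖) k

lemma maj_bound (v w : X) :
    (∀ k, Summable fun n => (1 / wt n + 1 / wt (k - n)) * (‖v n‖ * ‖w (k - n)‖)) ∧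
    (Summable fun k => maj v w k ^ 2) ∧
    ∑' k, maj v w k ^ 2 ≤ 4 * (∑' n, (1 / wt n) ^ 2) * (‖v‖ ^ 2 * ‖w‖ ^ 2) := by
  rw [norm_sq_eq v, norm_sq_eq w]
  exact wconv_bound (x := fun n => ‖v n‖) (y := fun n => ‖w n‖) (summable_norm_sq v)
    (summable_norm_sq w) (fun n => norm_nonneg (v n)) fun n => norm_nonneg (w n)

lemma norm_quad_term_le (v w : X) (k n : ℤ) :
    ‖P.wS k n • (v n * w (k - n))‖
      ≤ 4 * P.K * br k * ((1 / wt n + 1 / wt (k - n)) * (‖v n‖ * ‖w (k - n)‖)) := by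
  rw [norm_smul, ← mul_assoc]
  exact mul_le_mul (P.norm_wS_le k n) (norm_mul_le _ _) (norm_nonneg _)
    ((norm_nonneg _).trans (P.norm_wS_le k n))

lemma summable_norm_quad (v w : X) (k : ℤ) :
    Summable fun n => ‖P.wS k n • (v n * w (k - n))‖ :=
  (((maj_bound v w).1 k).mul_left _).of_nonneg_of_le (fun _ => norm_nonneg _)
    (P.norm_quad_term_le v w k)

lemma summable_quad (v w : X) (k : ℤ) :
    Summable fun n => P.wS k n • (v n * w (k - n)) :=
  (P.summable_norm_quad v w k).of_norm

lemma norm_quad_le (v w : X) (k : ℤ) : ‖P.quad v w k‖ ≤ 4 * P.K * br k * maj v w k := by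
  refine (norm_tsum_le_tsum_norm (P.summable_norm_quad v w k)).trans ?_
  rw [maj, wconv, ← tsum_mul_left]
  exact (P.summable_norm_quad v w k).tsum_le_tsum (P.norm_quad_term_le v w k)
    (((maj_bound v w).1 k).mul_left _)

lemma quad_sub_left (v v' w : X) (k : ℤ) :
    P.quad (v - v') w k = P.quad v w k - P.quad v' w k := by
  unfold quad
  rw [← (P.summable_quad v w k).tsum_sub (P.summable_quad v' w k)]
  refine tsum_congr fun n => ?_
  rw [← smul_sub, ← sub_mul]; rfl

lemma quad_sub_right (v w w' : X) (k : ℤ) :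
    P.quad v (w - w') k = P.quad v w k - P.quad v w' k := by
  unfold quad
  rw [← (P.summable_quad v w k).tsum_sub (P.summable_quad v w' k)]
  refine tsum_congr fun n => ?_
  rw [← smul_sub, ← mul_sub]; rfl

lemma norm_duhamel_quad_le (v w : X) (k : ℤ) :
    ‖P.duhamelCb k (P.quad v w k)‖ ≤ 4 * P.K * P.κ * maj v w k := by
  refine (P.norm_duhamelCb_le k _).trans ?_
  rw [div_le_iff₀ (br_pos k)]
  have := mul_le_mul_of_nonneg_left (P.norm_quad_le v w k) P.κ_nonneg
  linarith

lemma summable_duhamel_quad (v w : X) :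
    Summable fun k => ‖P.duhamelCb k (P.quad v w k)‖ ^ 2 := by
  refine ((maj_bound v w).2.1.mul_left ((4 * P.K * P.κ) ^ 2)).of_nonneg_of_le
    (fun _ => sq_nonneg _) fun k => ?_
  rw [← mul_pow]
  exact pow_le_pow_left₀ (norm_nonneg _) (P.norm_duhamel_quad_le v w k) 2

/-- The bilinear operator of the mild formulation. -/
def bilin (v w : X) : X :=
  ⟨fun k => P.duhamelCb k (P.quad v w k), memℓp_of_summable_sq (P.summable_duhamel_quad v w)⟩

/-- The constant `2 (∑ (1 + k²)⁻²)^(1/2)` of the convolution inequality. -/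
def convConst : ℝ := 2 * √(∑' n, (1 / wt n) ^ 2)

lemma convConst_nonneg : 0 ≤ convConst := by unfold convConst; positivity

lemma norm_bilin_le (v w : X) :
    ‖P.bilin v w‖ ≤ 4 * P.K * P.κ * convConst * (‖v‖ * ‖w‖) := by
  have hK := P.K_nonneg
  have hκ := P.κ_nonneg
  have hc := convConst_nonneg
  refine (sq_le_sq₀ (norm_nonneg _) (by positivity)).mp ?_
  have h := (maj_bound v w).2
  have hsq : convConst ^ 2 = 4 * ∑' n, (1 / wt n) ^ 2 := by
    rw [convConst, mul_pow, Real.sq_sqrt (tsum_nonneg fun n => sq_nonneg _)]; norm_num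
  have h1 : ‖P.bilin v w‖ ^ 2 ≤ (4 * P.K * P.κ) ^ 2 * ∑' k, maj v w k ^ 2 := by
    rw [norm_sq_eq (P.bilin v w), ← tsum_mul_left]
    refine (P.summable_duhamel_quad v w).tsum_le_tsum (fun k => ?_) (h.1.mul_left _)
    rw [← mul_pow]
    exact pow_le_pow_left₀ (norm_nonneg _) (P.norm_duhamel_quad_le v w k) 2
  refine h1.trans ((mul_le_mul_of_nonneg_left h.2 (sq_nonneg _)).trans (le_of_eq ?_))
  rw [← hsq]; ring

lemma bilin_sub_left (v v' w : X) : P.bilin (v - v') w = P.bilin v w - P.bilin v' w := by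
  ext1; funext k
  change P.duhamelCb k _ = P.duhamelCb k _ - P.duhamelCb k _
  rw [quad_sub_left, duhamelCb_sub]

lemma bilin_sub_right (v w w' : X) : P.bilin v (w - w') = P.bilin v w - P.bilin v w' := by
  ext1; funext k
  change P.duhamelCb k _ = P.duhamelCb k _ - P.duhamelCb k _
  rw [quad_sub_right, duhamelCb_sub]

end ParabolicSystem
namespace ParabolicSystem
variable (P : ParabolicSystem)

/-! ### Solving the system -/

lemma quad_apply (v w : X) (k : ℤ) (t : ℝ) :
    P.quad v w k t = ∑' n, P.wS k n * (v n t * w (k - n) t) := by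
  have h := (BoundedContinuousFunction.evalCLM ℂ t).map_tsum (P.summable_quad v w k)
  exact h

lemma duhamel_star {k : ℤ} {f g : Cb} (h : ∀ t, g t = star (f t)) (t : ℝ) :
    P.duhamel (-k) g t = star (P.duhamel k f t) := by
  have hc : ∀ z : ℂ, Complex.exp (star z) = star (Complex.exp z) := fun z => Complex.exp_conj z
  have hi : ∫ s in (0 : ℝ)..P.p t, Complex.exp ((P.μ (-k) - 2 * P.a) * s) * g s
      = star (∫ s in (0 : ℝ)..P.p t, Complex.exp ((P.μ k - 2 * P.a) * s) * f s) := by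
    rw [show star (∫ s in (0 : ℝ)..P.p t, Complex.exp ((P.μ k - 2 * P.a) * s) * f s)
      = ∫ s in (0 : ℝ)..P.p t, star (Complex.exp ((P.μ k - 2 * P.a) * s) * f s) from ?_]
    · refine intervalIntegral.integral_congr fun s _ => ?_
      rw [star_mul', ← hc, h, P.μ_neg]
      congr 2
      simp [Complex.conj_ofReal]
    · rw [intervalIntegral.integral_of_le (P.p_nonneg t),
        intervalIntegral.integral_of_le (P.p_nonneg t)]
      exact integral_conj.symm
  unfold duhamel
  rw [hi, star_mul', ← hc, P.μ_neg]
  congr 2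
  simp [Complex.conj_ofReal]

lemma wS_neg (k n : ℤ) : P.wS (-k) (-n) = star (P.wS k n) := by
  have h : -k - -n = -(k - n) := by ring
  rw [wS, wS, P.S_neg, wt_neg, wt_neg, h, wt_neg]
  simp [Complex.conj_ofReal]

/-- Reality of `u` is the symmetry `u_{-k} = conj u_k`; the mild formulation preserves it because
both symbols have it. -/
lemma quad_star {v : X} (hv : ∀ k t, v (-k) t = star (v k t)) (k : ℤ) (t : ℝ) :
    P.quad v v (-k) t = star (P.quad v v k t) := by
  rw [quad_apply, quad_apply, tsum_star, ← (Equiv.neg ℤ).tsum_eq]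
  refine tsum_congr fun n => ?_
  have h : -k - -n = -(k - n) := by ring
  rw [Equiv.neg_apply, wS_neg, h, hv, hv, star_mul', star_mul']

lemma quad_zero (v w : X) : P.quad v w 0 = 0 := by
  unfold quad wS
  simp [P.S_zero]

variable {a₀ : ℤ → ℂ}

lemma norm_exp_p_le (k : ℤ) (t : ℝ) : ‖Complex.exp (-(P.μ k - P.a) * P.p t)‖ ≤
    Real.exp (-(P.η * wt k * P.p t)) := by
  rw [Complex.norm_exp, Real.exp_le_exp]
  have h1 : (-(P.μ k - P.a) * P.p t).re = -((P.μ k).re - P.a) * P.p t := by simp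
  rw [h1]
  have := mul_le_mul_of_nonneg_right (P.re_le k) (P.p_nonneg t)
  linarith

/-- The free evolution of the datum `a₀`, mode by mode. -/
def free (a₀ : ℤ → ℂ) (k : ℤ) : Cb :=
  BoundedContinuousFunction.ofNormedAddCommGroup
    (fun t => Complex.exp (-(P.μ k - P.a) * P.p t) * ((wt k : ℂ) * a₀ k))
    (by have := P.p_cont; fun_prop) (wt k * ‖a₀ k‖) fun t => by
      have h := (P.norm_exp_p_le k t).trans
        (Real.exp_le_one_iff.mpr (by
          have := mul_nonneg (P.rate_pos k).le (P.p_nonneg t); linarith))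
      rw [norm_mul, norm_mul, Complex.norm_of_nonneg (wt_pos k).le]
      exact mul_le_of_le_one_left (mul_nonneg (wt_pos k).le (norm_nonneg _)) h

lemma norm_free_le (k : ℤ) : ‖P.free a₀ k‖ ≤ wt k * ‖a₀ k‖ :=
  BoundedContinuousFunction.norm_ofNormedAddCommGroup_le _
    (mul_nonneg (wt_pos k).le (norm_nonneg _)) _

lemma summable_free (h : Summable fun k => (wt k * ‖a₀ k‖) ^ 2) :
    Summable fun k => ‖P.free a₀ k‖ ^ 2 :=
  h.of_nonneg_of_le (fun _ => sq_nonneg _) fun k =>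
    pow_le_pow_left₀ (norm_nonneg _) (P.norm_free_le k) 2

lemma isClosed_symmetric : IsClosed {v : X | ∀ k t, v (-k) t = star (v k t)} := by
  have hc : ∀ (k : ℤ) (t : ℝ), Continuous fun v : X => v k t := fun k t => by
    have h1 : Continuous fun v : X => (v k : Cb) :=
      (continuous_apply k).comp (lp.uniformContinuous_coe (p := 2)).continuous
    exact (BoundedContinuousFunction.evalCLM ℂ t).continuous.comp h1
  simp only [Set.ofPred_forall]
  refine isClosed_iInter fun k => isClosed_iInter fun t => ?_
  exact isClosed_eq (hc _ _) (continuous_star.comp (hc _ _))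

/-- A family of Fourier modes solving the system on `P.I` with the datum `a₀`, together with
bounds in `H²`, with exponential weight, and a parabolic smoothing estimate. -/
structure IsModeSolution (a₀ : ℤ → ℂ) (r : ℝ) (u : ℤ → ℝ → ℂ) (V Q : ℤ → ℝ) : Prop where
  init : ∀ k, u k 0 = a₀ k
  zero : ∀ t, u 0 t = 0
  neg : ∀ k t, u (-k) t = star (u k t)
  cont : ∀ k, Continuous (u k)
  V_nonneg : ∀ k, 0 ≤ V k
  summable_V : Summable fun k => V k ^ 2
  tsum_V_le : ∑' k, V k ^ 2 ≤ (2 * r) ^ 2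
  bound : ∀ k, ∀ t, wt k * ‖u k t‖ ≤ Real.exp (-(P.a * t)) * V k
  Q_nonneg : ∀ k, 0 ≤ Q k
  summable_Q : Summable fun k => Q k ^ 2
  smoothing : ∀ k, ∀ t ∈ P.I, wt k * ‖u k t‖ ≤ Real.exp (-(P.a * t)) *
    (Real.exp (-(P.η * wt k * t)) * (wt k * ‖a₀ k‖) + Q k / br k)
  deriv : ∀ k, ∀ t ∈ P.I, HasDerivWithinAt (u k)
    (-P.μ k * u k t + ∑' n, P.S k n * (u n t * u (k - n) t)) P.I t

/-- The modes of the fixed point. -/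
def modes (v : X) (k : ℤ) (t : ℝ) : ℂ := Complex.exp (-(P.a * t : ℝ)) * v k t / (wt k : ℂ)

/-- On `P.I` the retraction is the identity, so undoing the weight leaves `e^{-μt}` times the datum
plus a primitive of a continuous function, and the fundamental theorem of calculus applies to each
mode. -/
lemma hasDerivWithinAt_modes {v : X} (h : ∀ k t, v k t =
      Complex.exp (-(P.μ k - P.a) * P.p t) * ((wt k : ℂ) * a₀ k) + P.duhamel k (P.quad v v k) t)
    (k : ℤ) {t : ℝ} (ht : t ∈ P.I) :
    HasDerivWithinAt (P.modes v k)
      (-P.μ k * P.modes v k t + ∑' n, P.S k n * (P.modes v n t * P.modes v (k - n) t)) P.I t := by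
  have hw : (wt k : ℂ) ≠ 0 := by exact_mod_cast (wt_pos k).ne'
  set q := P.quad v v k
  set F : ℝ → ℂ := fun t => ∫ s in (0 : ℝ)..t, Complex.exp ((P.μ k - 2 * P.a) * s) * q s
  have hF : HasDerivAt F (Complex.exp ((P.μ k - 2 * P.a) * t) * q t) t :=
    (P.integrand_cont k q).integral_hasStrictDerivAt 0 t |>.hasDerivAt
  have hexp : ∀ c : ℂ, HasDerivAt (fun s : ℝ => Complex.exp (c * s)) (c * Complex.exp (c * t)) t := by
    intro c
    have h1 : HasDerivAt (fun s : ℝ => c * (s : ℂ)) c t := by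
      simpa using (Complex.ofRealCLM.hasDerivAt (x := t)).const_mul c
    simpa [mul_comm] using h1.cexp
  have hG := ((hexp (-P.μ k)).mul (hF.const_add ((wt k : ℂ) * a₀ k))).div_const (wt k : ℂ)
  have heq : ∀ s ∈ P.I, P.modes v k s
      = Complex.exp (-P.μ k * s) * ((wt k : ℂ) * a₀ k + F s) / wt k := by
    intro s hs
    rw [modes, h, duhamel, P.p_eq s hs, ← mul_add, ← mul_assoc, ← Complex.exp_add]
    congr 3
    push_cast; ring
  refine (hG.hasDerivWithinAt (s := P.I)).congr_deriv ?_ |>.congr heq (heq t ht)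
  have hsum : ∑' n, P.S k n * (P.modes v n t * P.modes v (k - n) t)
      = Complex.exp (-(2 * P.a * t : ℝ)) * q t / wt k := by
    rw [show q t = _ from P.quad_apply v v k t, ← tsum_mul_left, ← tsum_div_const]
    refine tsum_congr fun n => ?_
    have h1 : (wt n : ℂ) ≠ 0 := by exact_mod_cast (wt_pos n).ne'
    have h2 : (wt (k - n) : ℂ) ≠ 0 := by exact_mod_cast (wt_pos _).ne'
    have h3 : Complex.exp (-(2 * P.a * t : ℝ))
        = Complex.exp (-(P.a * t : ℝ)) * Complex.exp (-(P.a * t : ℝ)) := by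
      rw [← Complex.exp_add]; congr 1; push_cast; ring
    rw [h3, modes, modes, wS]
    field_simp
  rw [hsum, heq t ht]
  have h4 : Complex.exp (-(2 * P.a * t : ℝ))
      = Complex.exp (-P.μ k * t) * Complex.exp ((P.μ k - 2 * P.a) * t) := by
    rw [← Complex.exp_add]; congr 1; push_cast; ring
  rw [h4]
  ring

theorem exists_modeSolution {r : ℝ} (ha : Summable fun k => (wt k * ‖a₀ k‖) ^ 2) (ha0 : a₀ 0 = 0)
    (hneg : ∀ k, a₀ (-k) = star (a₀ k)) (hr : 0 ≤ r) (har : ∑' k, (wt k * ‖a₀ k‖) ^ 2 ≤ r ^ 2)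
    (hsmall : 4 * (4 * P.K * P.κ * convConst) * r < 1) :
    ∃ u V Q, P.IsModeSolution a₀ r u V Q := by
  set x₀ : X := ⟨P.free a₀, memℓp_of_summable_sq (P.summable_free ha)⟩ with hx₀
  have hx₀r : ‖x₀‖ ≤ r := by
    refine (sq_le_sq₀ (norm_nonneg _) hr).mp (le_trans ?_ har)
    rw [norm_sq_eq x₀]
    exact (P.summable_free ha).tsum_le_tsum
      (fun k => pow_le_pow_left₀ (norm_nonneg _) (P.norm_free_le k) 2) ha
  have hKκ : 0 ≤ 4 * P.K * P.κ * convConst :=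
    mul_nonneg (mul_nonneg (mul_nonneg (by norm_num) P.K_nonneg) P.κ_nonneg) convConst_nonneg
  have hfree : ∀ k t, x₀ (-k) t = star (x₀ k t) := by
    intro k t
    change Complex.exp _ * _ = star (Complex.exp _ * _)
    have hc : ∀ z : ℂ, star (Complex.exp z) = Complex.exp (star z) :=
      fun z => (Complex.exp_conj z).symm
    rw [star_mul', star_mul', hc, P.μ_neg, wt_neg, hneg]
    congr 1
    · congr 1; simp [Complex.conj_ofReal]
    · simp [Complex.conj_ofReal]
  obtain ⟨v, hvD, hv, hfix⟩ := exists_quadratic_fixedPoint P.bilin hKκ P.bilin_sub_left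
    P.bilin_sub_right P.norm_bilin_le hx₀r hsmall isClosed_symmetric hfree (by
      intro v hv k t
      change x₀ (-k) t + P.duhamel (-k) (P.quad v v (-k)) t
        = star (x₀ k t + P.duhamel k (P.quad v v k) t)
      rw [star_add, hfree, P.duhamel_star (P.quad_star hv k)])
  have hfix' : ∀ k t, v k t = Complex.exp (-(P.μ k - P.a) * P.p t) * ((wt k : ℂ) * a₀ k)
      + P.duhamel k (P.quad v v k) t := fun k t => by
    conv_lhs => rw [hfix]
    rfl
  have hnorm : ∀ k t, wt k * ‖P.modes v k t‖ = Real.exp (-(P.a * t)) * ‖v k t‖ := by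
    intro k t
    have hw := wt_pos k
    rw [modes, norm_div, norm_mul, Complex.norm_of_nonneg hw.le, ← Complex.ofReal_neg,
      Complex.norm_exp_ofReal]
    field_simp
  have hp0 : P.p 0 = 0 := P.p_eq 0 P.zero_mem
  -- `V` is the supremum in time of each mode. `Q` comes from `4K br k · maj / (η wt k)` and `br k ^
  -- 2 ≤ 2 wt k`.
  refine ⟨P.modes v, fun k => ‖v k‖, fun k => 8 * P.K / P.η * maj v v k,
    { init := fun k => ?_
      zero := fun t => ?_
      neg := fun k t => ?_
      cont := fun k => ?_
      V_nonneg := fun k => norm_nonneg _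
      summable_V := summable_norm_sq v
      tsum_V_le := ?_
      bound := fun k t => ?_
      Q_nonneg := fun k => ?_
      summable_Q := ?_
      smoothing := fun k t ht => ?_
      deriv := fun k t ht => P.hasDerivWithinAt_modes hfix' k ht }⟩
  · have hw : (wt k : ℂ) ≠ 0 := by exact_mod_cast (wt_pos k).ne'
    rw [modes, hfix', duhamel, hp0]
    simp [hw]
  · rw [modes, hfix', quad_zero]
    simp [duhamel, ha0]
  · rw [modes, modes, hvD, wt_neg]
    simp [Complex.conj_ofReal, ← Complex.exp_conj]
  · have := (v k).continuous
    unfold modes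
    fun_prop
  · rw [← norm_sq_eq v]
    exact pow_le_pow_left₀ (norm_nonneg _) hv 2
  · rw [hnorm]
    exact mul_le_mul_of_nonneg_left ((v k).norm_coe_le_norm t) (Real.exp_nonneg _)
  · exact mul_nonneg (div_nonneg (mul_nonneg (by norm_num) P.K_nonneg) P.η_pos.le)
      (wconv_nonneg (fun n => norm_nonneg _) (fun n => norm_nonneg _) k)
  · simp only [mul_pow]
    exact (maj_bound v v).2.1.mul_left _
  · rw [hnorm, hfix']
    refine mul_le_mul_of_nonneg_left ((norm_add_le _ _).trans (add_le_add ?_ ?_))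
      (Real.exp_nonneg _)
    · rw [norm_mul, norm_mul, Complex.norm_of_nonneg (wt_pos k).le]
      have h := P.norm_exp_p_le k t
      rw [P.p_eq t ht] at h ⊢
      exact mul_le_mul_of_nonneg_right h (mul_nonneg (wt_pos k).le (norm_nonneg _))
    · refine (P.norm_duhamel_le_rate k _ t).trans ?_
      have hm : 0 ≤ maj v v k :=
        wconv_nonneg (fun n => norm_nonneg _) (fun n => norm_nonneg _) k
      have hη := P.η_pos
      have hb := br_pos k
      have hw := wt_pos k
      rw [div_le_div_iff₀ (P.rate_pos k) hb]
      have h1 := mul_le_mul_of_nonneg_right (P.norm_quad_le v v k) hb.le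
      have h2 := mul_le_mul_of_nonneg_left (br_sq_le k)
        (mul_nonneg (mul_nonneg (by norm_num : (0:ℝ) ≤ 4) P.K_nonneg) hm)
      have e : 8 * P.K / P.η * maj v v k * (P.η * wt k) = 4 * P.K * maj v v k * (2 * wt k) := by
        field_simp; ring
      rw [e]
      linarith

end ParabolicSystem

/-! ### The symbols of the equation -/

/-- The symbol of `N`. -/
def nsym (δ : ℝ) (k : ℤ) : ℂ := (1 - (δ : ℂ) * Complex.I * (k : ℂ)) / (1 + (δ : ℂ) ^ 2 * (k : ℂ) ^ 2)

/-- The symbol of the quadratic nonlinearity, with frequencies `n` and `k - n`. -/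
def nlsym (δ β : ℝ) (k n : ℤ) : ℂ :=
  2 * (Complex.I * ((k - n : ℤ) : ℂ))
    + ((|k| : ℤ) : ℂ) * (-Complex.I * ((Int.sign k - Int.sign (k - n) : ℤ) : ℂ)) / ((|n| : ℤ) : ℂ)
    + β * ((|k| : ℤ) : ℂ) * (-Complex.I * ((Int.sign k - Int.sign (k - n) : ℤ) : ℂ))
        * ((k - n : ℤ) : ℂ) ^ 2 / ((|n| : ℤ) : ℂ)
    - δ * ((|k| : ℤ) : ℂ) * (-Complex.I * ((Int.sign k - Int.sign (k - n) : ℤ) : ℂ))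
        * (Complex.I * ((k - n : ℤ) : ℂ))
    + δ * (Complex.I * k) * (Complex.I * ((k - n : ℤ) : ℂ))
    + δ * ((|k| : ℤ) : ℂ) * (((k - n : ℤ) : ℂ) ^ 2 - (k : ℂ) ^ 2) / ((|n| : ℤ) : ℂ)

/-- The symbol of `N` applied to the nonlinearity, acting on zero-mean functions. -/
def bilsym (δ β : ℝ) (k n : ℤ) : ℂ :=
  if k = 0 ∨ n = 0 ∨ k = n then 0 else nsym δ k * nlsym δ β k n

/-- The symbol `μ` of the linear part, written as `u_t = -μ u`. -/
def linsym (ε δ β : ℝ) (k : ℤ) : ℂ :=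
  (δ * (k : ℂ) ^ 2 + Complex.I * (Int.sign k : ℤ) * (1 + β * (k : ℂ) ^ 2) / (1 + δ ^ 2 * (k : ℂ) ^ 2)
    + δ * ((|k| : ℤ) : ℂ) * (1 + β * (k : ℂ) ^ 2) / (1 + δ ^ 2 * (k : ℂ) ^ 2)
    - Complex.I * k) / (2 * ε)

lemma one_add_sq_pos (δ : ℝ) (k : ℤ) : 0 < 1 + δ ^ 2 * (k : ℝ) ^ 2 := by positivity

lemma one_add_sq_ne (δ : ℝ) (k : ℤ) : (1 + (δ : ℂ) ^ 2 * (k : ℂ) ^ 2) ≠ 0 := by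
  have := (one_add_sq_pos δ k).ne'
  exact_mod_cast this

lemma sq_norm_nsym (δ : ℝ) (k : ℤ) : ‖nsym δ k‖ ^ 2 * (1 + δ ^ 2 * (k : ℝ) ^ 2) = 1 := by
  have hpos := one_add_sq_pos δ k
  have h1 : ‖(1 - (δ : ℂ) * Complex.I * (k : ℂ))‖ ^ 2 = 1 + δ ^ 2 * (k : ℝ) ^ 2 := by
    rw [← Complex.normSq_eq_norm_sq, Complex.normSq_apply]
    simp; ring
  have h2 : ‖(1 + (δ : ℂ) ^ 2 * (k : ℂ) ^ 2)‖ = 1 + δ ^ 2 * (k : ℝ) ^ 2 := by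
    rw [show (1 + (δ : ℂ) ^ 2 * (k : ℂ) ^ 2) = ((1 + δ ^ 2 * (k : ℝ) ^ 2 : ℝ) : ℂ) by push_cast; ring]
    exact Complex.norm_of_nonneg hpos.le
  rw [nsym, norm_div, div_pow, h1, h2]
  field_simp

lemma norm_nsym_le_one (δ : ℝ) (k : ℤ) : ‖nsym δ k‖ ≤ 1 := by
  have h := sq_norm_nsym δ k
  refine (sq_le_sq₀ (norm_nonneg _) zero_le_one).mp ?_
  nlinarith [mul_nonneg (sq_nonneg ‖nsym δ k‖) (mul_nonneg (sq_nonneg δ) (sq_nonneg (k : ℝ)))]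

lemma norm_nsym_mul_le {δ : ℝ} (hδ : 0 < δ) (k : ℤ) : ‖nsym δ k‖ * |(k : ℝ)| ≤ 1 / δ := by
  have h := sq_norm_nsym δ k
  rw [le_div_iff₀ hδ]
  refine (sq_le_sq₀ (by positivity) zero_le_one).mp ?_
  rw [mul_pow, mul_pow, sq_abs]
  nlinarith [sq_nonneg ‖nsym δ k‖]

/-- If the signs of `k` and `k - n` differ, then `0` lies between them and `|k - n| ≤ |n|`. This
localization is the smoothing effect of the commutator with the Hilbert transform. -/
lemma abs_sign_sub_mul_le (k n : ℤ) : |Int.sign k - Int.sign (k - n)| * |k - n| ≤ 2 * |n| := by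
  have hcases : ∀ z : ℤ, (z < 0 ∧ Int.sign z = -1) ∨ (z = 0 ∧ Int.sign z = 0) ∨
      (0 < z ∧ Int.sign z = 1) := fun z => by
    rcases lt_trichotomy z 0 with h | h | h
    · exact Or.inl ⟨h, Int.sign_eq_neg_one_of_neg h⟩
    · exact Or.inr (Or.inl ⟨h, by rw [h, Int.sign_zero]⟩)
    · exact Or.inr (Or.inr ⟨h, Int.sign_eq_one_of_pos h⟩)
  rcases hcases k with ⟨hk, h⟩ | ⟨hk, h⟩ | ⟨hk, h⟩ <;>
  rcases hcases (k - n) with ⟨hm, h'⟩ | ⟨hm, h'⟩ | ⟨hm, h'⟩ <;> rw [h, h'] <;>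
  rcases abs_cases n with ⟨e, _⟩ | ⟨e, _⟩ <;>
  rcases abs_cases (k - n) with ⟨e', _⟩ | ⟨e', _⟩ <;> rw [e, e'] <;> norm_num <;> omega

lemma abs_sign_sub_le (k n : ℤ) : |Int.sign k - Int.sign n| ≤ 2 := by
  rcases Int.sign_trichotomy k with h | h | h <;>
  rcases Int.sign_trichotomy n with h' | h' | h' <;> rw [h, h'] <;> decide

/-- In the `β` term the sign difference converts one factor `k - n` into `n`, which cancels `Λ⁻¹`.
Apart from the outer `|k|`, at most one derivative remains in every term. -/
lemma norm_nlsym_le {δ β : ℝ} (hδ : 0 < δ) (hβ : 0 ≤ β) {k n : ℤ} (hn : n ≠ 0) :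
    ‖nlsym δ β k n‖ ≤ 2 * (br n + br (k - n))
      + |(k : ℝ)| * ((2 + 2 * β + 5 * δ) * (br n + br (k - n))) := by
  obtain ⟨m, rfl⟩ : ∃ m, k = n + m := ⟨k - n, by ring⟩
  rw [nlsym, show n + m - n = m by ring]
  set k := n + m with hk
  have hs1 : |((Int.sign k - Int.sign m : ℤ) : ℝ)| ≤ 2 := by exact_mod_cast abs_sign_sub_le k m
  have hs2 : |((Int.sign k - Int.sign m : ℤ) : ℝ)| * |(m : ℝ)| ≤ 2 * |(n : ℝ)| := by
    have := abs_sign_sub_mul_le k n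
    rw [hk, add_sub_cancel_left] at this
    exact_mod_cast this
  set s : ℤ := Int.sign k - Int.sign m
  have hn1 : 1 ≤ |(n : ℝ)| := by exact_mod_cast Int.one_le_abs hn
  have hn0 : 0 < |(n : ℝ)| := by linarith
  have hk0 := abs_nonneg (k : ℝ)
  have hm0 := abs_nonneg (m : ℝ)
  have nI : ‖Complex.I‖ = 1 := Complex.norm_I
  have nz : ∀ z : ℤ, ‖(z : ℂ)‖ = |(z : ℝ)| := fun z => Complex.norm_intCast z
  have na : ∀ z : ℤ, ‖((|z| : ℤ) : ℂ)‖ = |(z : ℝ)| := fun z => by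
    rw [Complex.norm_intCast]; push_cast; exact abs_abs _
  have nr : ∀ x : ℝ, 0 ≤ x → ‖(x : ℂ)‖ = x := fun x hx => Complex.norm_of_nonneg hx
  have t1 : ‖2 * (Complex.I * (m : ℂ))‖ = 2 * |(m : ℝ)| := by
    rw [norm_mul, norm_mul, nI, nz, one_mul]; simp
  have t2 : ‖((|k| : ℤ) : ℂ) * (-Complex.I * (s : ℂ)) / ((|n| : ℤ) : ℂ)‖ ≤ 2 * |(k : ℝ)| := by
    rw [norm_div, norm_mul, norm_mul, norm_neg, nI, na, na, nz, one_mul, div_le_iff₀ hn0]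
    nlinarith [mul_nonneg hk0 (sub_nonneg.mpr hs1), mul_nonneg hk0 (sub_nonneg.mpr hn1)]
  have t3 : ‖β * ((|k| : ℤ) : ℂ) * (-Complex.I * (s : ℂ)) * (m : ℂ) ^ 2 / ((|n| : ℤ) : ℂ)‖
      ≤ 2 * β * |(k : ℝ)| * |(m : ℝ)| := by
    rw [norm_div, norm_mul, norm_mul, norm_mul, norm_mul, norm_neg, norm_pow, nI, na, na, nz, nz,
      nr β hβ, one_mul, div_le_iff₀ hn0]
    have := mul_le_mul_of_nonneg_left hs2 (mul_nonneg (mul_nonneg hβ hk0) hm0)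
    linarith
  have t4 : ‖δ * ((|k| : ℤ) : ℂ) * (-Complex.I * (s : ℂ)) * (Complex.I * (m : ℂ))‖
      ≤ 2 * δ * |(k : ℝ)| * |(m : ℝ)| := by
    rw [norm_mul, norm_mul, norm_mul, norm_mul, norm_mul, norm_neg, nI, na, nz, nz, nr δ hδ.le,
      one_mul, one_mul]
    have := mul_le_mul_of_nonneg_left hs1 (mul_nonneg (mul_nonneg hδ.le hk0) hm0)
    linarith
  have t5 : ‖δ * (Complex.I * (k : ℂ)) * (Complex.I * (m : ℂ))‖ = δ * |(k : ℝ)| * |(m : ℝ)| := by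
    rw [norm_mul, norm_mul, norm_mul, norm_mul, nI, nz, nz, nr δ hδ.le, one_mul, one_mul]
  have t6 : ‖δ * ((|k| : ℤ) : ℂ) * ((m : ℂ) ^ 2 - (k : ℂ) ^ 2) / ((|n| : ℤ) : ℂ)‖
      ≤ δ * |(k : ℝ)| * (|(n : ℝ)| + 2 * |(m : ℝ)|) := by
    -- The commutator with `∂ₓ²` is a difference of squares, divisible by `n`, which again cancels
    -- `Λ⁻¹`.
    have e : (m : ℂ) ^ 2 - (k : ℂ) ^ 2 = -((n : ℂ) * ((n + 2 * m : ℤ) : ℂ)) := by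
      rw [hk]; push_cast; ring
    rw [e, norm_div, norm_mul, norm_mul, norm_neg, norm_mul, na, na, nz, nz, nr δ hδ.le,
      div_le_iff₀ hn0]
    have h : |((n + 2 * m : ℤ) : ℝ)| ≤ |(n : ℝ)| + 2 * |(m : ℝ)| := by
      push_cast
      refine (abs_add_le _ _).trans ?_
      rw [abs_mul, abs_two]
    have := mul_le_mul_of_nonneg_left h (mul_nonneg (mul_nonneg hδ.le hk0) hn0.le)
    linarith
  refine (norm_add_le _ _).trans ?_
  have hA := norm_add_le (2 * (Complex.I * (m : ℂ)))
    (((|k| : ℤ) : ℂ) * (-Complex.I * (s : ℂ)) / ((|n| : ℤ) : ℂ))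
  have hB := norm_add_le (2 * (Complex.I * (m : ℂ))
    + ((|k| : ℤ) : ℂ) * (-Complex.I * (s : ℂ)) / ((|n| : ℤ) : ℂ))
    (β * ((|k| : ℤ) : ℂ) * (-Complex.I * (s : ℂ)) * (m : ℂ) ^ 2 / ((|n| : ℤ) : ℂ))
  have hC := norm_sub_le (2 * (Complex.I * (m : ℂ))
    + ((|k| : ℤ) : ℂ) * (-Complex.I * (s : ℂ)) / ((|n| : ℤ) : ℂ)
    + β * ((|k| : ℤ) : ℂ) * (-Complex.I * (s : ℂ)) * (m : ℂ) ^ 2 / ((|n| : ℤ) : ℂ))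
    (δ * ((|k| : ℤ) : ℂ) * (-Complex.I * (s : ℂ)) * (Complex.I * (m : ℂ)))
  have hD := norm_add_le (2 * (Complex.I * (m : ℂ))
    + ((|k| : ℤ) : ℂ) * (-Complex.I * (s : ℂ)) / ((|n| : ℤ) : ℂ)
    + β * ((|k| : ℤ) : ℂ) * (-Complex.I * (s : ℂ)) * (m : ℂ) ^ 2 / ((|n| : ℤ) : ℂ)
    - δ * ((|k| : ℤ) : ℂ) * (-Complex.I * (s : ℂ)) * (Complex.I * (m : ℂ)))
    (δ * (Complex.I * (k : ℂ)) * (Complex.I * (m : ℂ)))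
  have hfin : 2 * |(m : ℝ)| + 2 * |(k : ℝ)| + 2 * β * |(k : ℝ)| * |(m : ℝ)|
      + 2 * δ * |(k : ℝ)| * |(m : ℝ)| + δ * |(k : ℝ)| * |(m : ℝ)|
      + δ * |(k : ℝ)| * (|(n : ℝ)| + 2 * |(m : ℝ)|) ≤ 2 * (br n + br m)
      + |(k : ℝ)| * ((2 + 2 * β + 5 * δ) * (br n + br m)) := by
    unfold br
    have hkδ := mul_nonneg hk0 hδ.le
    have hkβ := mul_nonneg hk0 hβ
    nlinarith [mul_nonneg hkδ hn0.le, mul_nonneg hkβ hn0.le, mul_nonneg hkδ hm0,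
      mul_nonneg hkβ hm0, mul_nonneg hk0 hn0.le, mul_nonneg hk0 hm0]
  linarith

/-- The constant in the bound of `bilsym`. -/
def bilConst (δ β : ℝ) : ℝ := 2 + (2 + 2 * β + 5 * δ) / δ

lemma bilConst_nonneg {δ β : ℝ} (hδ : 0 < δ) (hβ : 0 ≤ β) : 0 ≤ bilConst δ β := by
  unfold bilConst; positivity

/-- `N` has order `-1`: its symbol is bounded by `1` and, multiplied by `|k|`, by `1/δ`, so it
removes the outer derivative of the nonlinearity. -/
lemma norm_bilsym_le {δ β : ℝ} (hδ : 0 < δ) (hβ : 0 ≤ β) (k n : ℤ) :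
    ‖bilsym δ β k n‖ ≤ bilConst δ β * (br n + br (k - n)) := by
  have hB : 0 ≤ br n + br (k - n) := add_nonneg (br_pos n).le (br_pos _).le
  unfold bilsym
  split_ifs with h
  · rw [norm_zero]; exact mul_nonneg (bilConst_nonneg hδ hβ) hB
  · push Not at h
    rw [norm_mul]
    have h0 : 0 ≤ (2 + 2 * β + 5 * δ) * (br n + br (k - n)) := by positivity
    calc ‖nsym δ k‖ * ‖nlsym δ β k n‖
        ≤ ‖nsym δ k‖ * (2 * (br n + br (k - n))
          + |(k : ℝ)| * ((2 + 2 * β + 5 * δ) * (br n + br (k - n)))) :=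
          mul_le_mul_of_nonneg_left (norm_nlsym_le hδ hβ h.2.1) (norm_nonneg _)
      _ = ‖nsym δ k‖ * (2 * (br n + br (k - n)))
          + ‖nsym δ k‖ * |(k : ℝ)| * ((2 + 2 * β + 5 * δ) * (br n + br (k - n))) := by ring
      _ ≤ 1 * (2 * (br n + br (k - n)))
          + 1 / δ * ((2 + 2 * β + 5 * δ) * (br n + br (k - n))) := by
          gcongr
          · exact norm_nsym_le_one δ k
          · exact norm_nsym_mul_le hδ k
      _ = _ := by unfold bilConst; ring

lemma nsym_neg (δ : ℝ) (k : ℤ) : nsym δ (-k) = star (nsym δ k) := by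
  simp [nsym, Complex.conj_ofReal]

lemma nlsym_neg (δ β : ℝ) (k n : ℤ) : nlsym δ β (-k) (-n) = star (nlsym δ β k n) := by
  have h : -k - -n = -(k - n) := by ring
  have h2 : Int.sign (-k) - Int.sign (-(k - n)) = -(Int.sign k - Int.sign (k - n)) := by
    rw [Int.sign_neg, Int.sign_neg]; ring
  unfold nlsym
  rw [h, h2, abs_neg, abs_neg]
  generalize k - n = m
  generalize Int.sign k - Int.sign m = s
  simp only [star_add, star_sub, star_mul', star_div₀, star_neg, Complex.star_def,
    Complex.conj_I, Complex.conj_ofReal, Int.cast_neg, map_ofNat, map_intCast, star_pow]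
  ring

lemma bilsym_neg (δ β : ℝ) (k n : ℤ) : bilsym δ β (-k) (-n) = star (bilsym δ β k n) := by
  unfold bilsym
  simp only [neg_eq_zero, neg_inj]
  split_ifs
  · simp
  · rw [nsym_neg, nlsym_neg, star_mul']

lemma linsym_neg (ε δ β : ℝ) (k : ℤ) : linsym ε δ β (-k) = star (linsym ε δ β k) := by
  unfold linsym
  rw [abs_neg, Int.sign_neg]
  simp only [star_add, star_sub, star_mul', star_div₀, Complex.star_def, map_pow,
    Complex.conj_I, Complex.conj_ofReal, Int.cast_neg, map_ofNat, map_intCast, star_one]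
  ring

lemma linsym_eq (ε δ β : ℝ) (k : ℤ) : linsym ε δ β k =
    (((δ * (k : ℝ) ^ 2 + δ * |(k : ℝ)| * (1 + β * (k : ℝ) ^ 2) / (1 + δ ^ 2 * (k : ℝ) ^ 2))
      / (2 * ε) : ℝ) : ℂ)
    + ((((Int.sign k : ℤ) * (1 + β * (k : ℝ) ^ 2) / (1 + δ ^ 2 * (k : ℝ) ^ 2) - k)
      / (2 * ε) : ℝ) : ℂ) * Complex.I := by
  have h : ((|k| : ℤ) : ℂ) = ((|(k : ℝ)| : ℝ) : ℂ) := by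
    rw [← Complex.ofReal_intCast, Int.cast_abs]
  unfold linsym
  rw [h]
  push_cast
  ring

lemma re_linsym (ε δ β : ℝ) (k : ℤ) : (linsym ε δ β k).re =
    (δ * (k : ℝ) ^ 2 + δ * |(k : ℝ)| * (1 + β * (k : ℝ) ^ 2) / (1 + δ ^ 2 * (k : ℝ) ^ 2))
      / (2 * ε) := by
  rw [linsym_eq]
  simp only [Complex.add_re, Complex.ofReal_re, Complex.mul_re, Complex.ofReal_im, Complex.I_re,
    Complex.I_im]
  ring

lemma le_re_linsym {ε δ β : ℝ} (hε : 0 < ε) (hδ : 0 < δ) (hβ : 0 ≤ β) (k : ℤ) :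
    δ / (2 * ε) * (k : ℝ) ^ 2 ≤ (linsym ε δ β k).re := by
  rw [re_linsym, div_mul_eq_mul_div]
  refine div_le_div_of_nonneg_right ?_ (by positivity)
  have : 0 ≤ δ * |(k : ℝ)| * (1 + β * (k : ℝ) ^ 2) / (1 + δ ^ 2 * (k : ℝ) ^ 2) := by positivity
  linarith

/-- The spectral gap at the rate `δ / (2 ε)` is strict, with a parabolic remainder. -/
lemma gap_le_re_linsym {ε δ β : ℝ} (hε : 0 < ε) (hδ : 0 < δ) (hβ : 0 ≤ β) {k : ℤ} (hk : k ≠ 0) :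
    δ / (2 * ε) + δ / (2 * ε) * (1 / (4 * (1 + δ ^ 2))) * wt k ≤ (linsym ε δ β k).re := by
  rw [re_linsym]
  have hd : 0 < 1 + δ ^ 2 := by positivity
  have hθ : 1 / (4 * (1 + δ ^ 2)) ≤ 1 / 4 :=
    one_div_le_one_div_of_le (by norm_num) (by nlinarith [sq_nonneg δ])
  have key : 1 + 1 / (4 * (1 + δ ^ 2)) * wt k
      ≤ (k : ℝ) ^ 2 + |(k : ℝ)| * (1 + β * (k : ℝ) ^ 2) / (1 + δ ^ 2 * (k : ℝ) ^ 2) := by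
    have hk1 : 1 ≤ |k| := Int.one_le_abs hk
    -- At `|k| = 1` the viscous term gives exactly the rate, so the surplus must come from the
    -- Hilbert term, of size at least `1/(1 + δ²)`; this dictates the coefficient. For `|k| ≥ 2` the
    -- viscous term alone suffices, the coefficient being at most `1/4`.
    rcases hk1.eq_or_lt with h1 | h2
    · have e1 : |(k : ℝ)| = 1 := by exact_mod_cast h1.symm
      have e2 : (k : ℝ) ^ 2 = 1 := by rw [← sq_abs, e1]; norm_num
      rw [wt, e1, e2]
      have h3 : 1 / (1 + δ ^ 2) ≤ 1 * (1 + β * 1) / (1 + δ ^ 2 * 1) := by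
        rw [mul_one, mul_one, one_mul]
        gcongr; linarith
      have h4 : 1 / (4 * (1 + δ ^ 2)) * (1 + 1) ≤ 1 / (1 + δ ^ 2) := by
        rw [one_div_mul_eq_div, div_le_div_iff₀ (by positivity) hd]
        linarith
      linarith
    · have e1 : (2 : ℝ) ≤ |(k : ℝ)| := by exact_mod_cast h2
      have e2 : (4 : ℝ) ≤ (k : ℝ) ^ 2 := by rw [← sq_abs]; nlinarith
      have e3 : 0 ≤ |(k : ℝ)| * (1 + β * (k : ℝ) ^ 2) / (1 + δ ^ 2 * (k : ℝ) ^ 2) := by positivity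
      have e4 := mul_le_mul_of_nonneg_right hθ (wt_pos k).le
      unfold wt at e4 ⊢
      linarith
  have := mul_le_mul_of_nonneg_left key (show 0 ≤ δ / (2 * ε) by positivity)
  calc _ = δ / (2 * ε) * (1 + 1 / (4 * (1 + δ ^ 2)) * wt k) := by ring
    _ ≤ _ := this
    _ = _ := by ring

lemma norm_linsym_le {ε δ β : ℝ} (hε : 0 < ε) (hδ : 0 < δ) (hβ : 0 ≤ β) (k : ℤ) :
    ‖linsym ε δ β k‖ ≤ (1 + δ) * (2 + β) / ε * wt k := by
  rw [linsym_eq]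
  have hw := wt_pos k
  have hD : 1 ≤ 1 + δ ^ 2 * (k : ℝ) ^ 2 := by nlinarith [mul_nonneg (sq_nonneg δ) (sq_nonneg (k : ℝ))]
  have hk : |(k : ℝ)| ≤ wt k := by unfold wt; nlinarith [sq_abs (k : ℝ), sq_nonneg (|(k : ℝ)| - 1)]
  have hs : |((Int.sign k : ℤ) : ℝ)| ≤ 1 := by
    rcases Int.sign_trichotomy k with h | h | h <;> rw [h] <;> norm_num
  have hk2 : (k : ℝ) ^ 2 ≤ wt k := by unfold wt; linarith
  have h1 : |(k : ℝ)| / (1 + δ ^ 2 * (k : ℝ) ^ 2) * δ ≤ 1 := by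
    rw [div_mul_eq_mul_div, div_le_one (by linarith)]
    nlinarith [sq_nonneg (δ * |(k : ℝ)| - 1), sq_abs (k : ℝ)]
  have hb : 1 + β * (k : ℝ) ^ 2 ≤ (1 + β) * wt k := by
    unfold wt; nlinarith [sq_nonneg (k : ℝ)]
  have hb0 : 0 ≤ 1 + β * (k : ℝ) ^ 2 := by positivity
  refine (norm_add_le _ _).trans ?_
  rw [norm_mul, Complex.norm_I, mul_one, Complex.norm_real, Complex.norm_real, Real.norm_eq_abs,
    Real.norm_eq_abs, abs_div, abs_div, abs_of_pos (show 0 < 2 * ε by positivity), ← add_div,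
    div_mul_eq_mul_div, div_le_div_iff₀ (by positivity) hε]
  have a1 : |δ * (k : ℝ) ^ 2 + δ * |(k : ℝ)| * (1 + β * (k : ℝ) ^ 2) / (1 + δ ^ 2 * (k : ℝ) ^ 2)|
      ≤ δ * wt k + (1 + β) * wt k := by
    rw [abs_of_nonneg (by positivity)]
    have : δ * |(k : ℝ)| * (1 + β * (k : ℝ) ^ 2) / (1 + δ ^ 2 * (k : ℝ) ^ 2)
        = (|(k : ℝ)| / (1 + δ ^ 2 * (k : ℝ) ^ 2) * δ) * (1 + β * (k : ℝ) ^ 2) := by ring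
    rw [this]
    have := mul_le_mul_of_nonneg_right h1 hb0
    have := mul_le_mul_of_nonneg_left hk2 hδ.le
    linarith
  have a2 : |(Int.sign k : ℤ) * (1 + β * (k : ℝ) ^ 2) / (1 + δ ^ 2 * (k : ℝ) ^ 2) - k|
      ≤ (1 + β) * wt k + wt k := by
    refine (abs_sub _ _).trans (add_le_add ?_ hk)
    rw [abs_div, abs_mul, abs_of_nonneg hb0, abs_of_pos (by linarith : 0 < 1 + δ ^ 2 * (k : ℝ) ^ 2)]
    refine (div_le_self (by positivity) hD).trans ?_
    nlinarith [mul_le_mul_of_nonneg_right hs hb0]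
  have := mul_nonneg (mul_nonneg hδ.le hβ) hw.le
  have := mul_nonneg hδ.le hw.le
  have := mul_nonneg hβ hw.le
  have h3 : |δ * (k : ℝ) ^ 2 + δ * |(k : ℝ)| * (1 + β * (k : ℝ) ^ 2) / (1 + δ ^ 2 * (k : ℝ) ^ 2)|
      + |(Int.sign k : ℤ) * (1 + β * (k : ℝ) ^ 2) / (1 + δ ^ 2 * (k : ℝ) ^ 2) - k|
      ≤ 2 * ((1 + δ) * (2 + β) * wt k) := by nlinarith
  have := mul_le_mul_of_nonneg_right h3 hε.le
  linarith

/-! ### The right-hand side of the equation in Fourier modes -/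

/-- Zero-mean sequences of Fourier coefficients of `H²` functions. -/
structure IsH2Seq (u : FSeq) : Prop where
  zero : u 0 = 0
  summable : Summable fun k => (wt k * ‖u k‖) ^ 2

/-- Bound of a sequence by a multiple of `wt k ‖u k‖`. -/
def WtBounded (u f : FSeq) : Prop := ∃ c : ℝ, ∀ k, ‖f k‖ ≤ c * (wt k * ‖u k‖)

lemma IsH2Seq.summable_sq {u f : FSeq} (hu : IsH2Seq u) (hf : WtBounded u f) :
    Summable fun k => ‖f k‖ ^ 2 := by
  obtain ⟨c, hc⟩ := hf
  refine (hu.summable.mul_left (c ^ 2)).of_nonneg_of_le (fun _ => sq_nonneg _) fun k => ?_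
  rw [← mul_pow]
  exact pow_le_pow_left₀ (norm_nonneg _) (hc k) 2

lemma summable_conv {f g : FSeq} (hf : Summable fun k => ‖f k‖ ^ 2)
    (hg : Summable fun k => ‖g k‖ ^ 2) (k : ℤ) : Summable fun n => f n * g (k - n) := by
  refine Summable.of_norm ?_
  simp only [norm_mul]
  exact summable_mul_of_sq hf ((Equiv.subLeft k).summable_iff.mpr hg)

lemma IsH2Seq.hasSum_conv {u f g : FSeq} (hu : IsH2Seq u) (hf : WtBounded u f)
    (hg : WtBounded u g) (k : ℤ) : HasSum (fun n => f n * g (k - n)) (conv f g k) :=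
  (summable_conv (hu.summable_sq hf) (hu.summable_sq hg) k).hasSum

lemma wtBounded_of_symbol {u f : FSeq} (h : ∀ k, ‖f k‖ ≤ wt k * ‖u k‖) : WtBounded u f :=
  ⟨1, fun k => by rw [one_mul]; exact h k⟩

lemma abs_le_wt (k : ℤ) : |(k : ℝ)| ≤ wt k := by
  unfold wt; nlinarith [sq_abs (k : ℝ), sq_nonneg (|(k : ℝ)| - 1)]

lemma sq_le_wt (k : ℤ) : |(k : ℝ)| ^ 2 ≤ wt k := by rw [sq_abs]; unfold wt; linarith

lemma norm_cast_abs (k : ℤ) : ‖((|k| : ℤ) : ℂ)‖ = |(k : ℝ)| := by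
  rw [Complex.norm_intCast]; push_cast; exact abs_abs _

lemma norm_sign_le (k : ℤ) : ‖((Int.sign k : ℤ) : ℂ)‖ ≤ 1 := by
  rw [Complex.norm_intCast]
  rcases Int.sign_trichotomy k with h | h | h <;> rw [h] <;> norm_num

lemma wtBounded_self (u : FSeq) : WtBounded u u :=
  wtBounded_of_symbol fun k => le_mul_of_one_le_left (norm_nonneg _) (one_le_wt k)

lemma WtBounded.of_symbol {u : FSeq} {σ : ℤ → ℂ} {f : FSeq} (h : ∀ k, f k = σ k * u k)
    (hσ : ∀ k, ‖σ k‖ ≤ wt k) : WtBounded u f :=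
  wtBounded_of_symbol fun k => by
    rw [h, norm_mul]; exact mul_le_mul_of_nonneg_right (hσ k) (norm_nonneg _)

lemma wtBounded_dx (u : FSeq) : WtBounded u (dx u) :=
  .of_symbol (fun _ => rfl) fun k => by
    rw [norm_mul, Complex.norm_I, one_mul, Complex.norm_intCast]; exact abs_le_wt k

lemma norm_I_sq_mul (k : ℤ) : ‖Complex.I * (k : ℂ) * (Complex.I * (k : ℂ))‖ ≤ wt k := by
  rw [norm_mul, norm_mul, Complex.norm_I, one_mul, Complex.norm_intCast, ← sq]
  exact sq_le_wt k

lemma wtBounded_dxdx (u : FSeq) : WtBounded u (dx (dx u)) :=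
  .of_symbol (σ := fun k => Complex.I * (k : ℂ) * (Complex.I * (k : ℂ)))
    (fun k => by simp only [dx]; ring) norm_I_sq_mul

lemma wtBounded_LamLam (u : FSeq) : WtBounded u (Lam (Lam u)) :=
  .of_symbol (σ := fun k => ((|k| : ℤ) : ℂ) * ((|k| : ℤ) : ℂ))
    (fun k => by simp only [Lam]; ring) fun k => by
    rw [norm_mul, norm_cast_abs, ← sq]; exact sq_le_wt k

lemma WtBounded.hilb {u f : FSeq} (h : WtBounded u f) : WtBounded u (hilb f) := by
  obtain ⟨c, hc⟩ := h
  refine ⟨c, fun k => le_trans ?_ (hc k)⟩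
  rw [ViscousWave.hilb, norm_mul, norm_mul, norm_neg, Complex.norm_I, one_mul]
  exact mul_le_of_le_one_left (norm_nonneg _) (norm_sign_le k)

lemma LamInv_eq {u : FSeq} (hu : u 0 = 0) (n : ℤ) : LamInv u n = u n / ((|n| : ℤ) : ℂ) := by
  unfold LamInv
  split_ifs with h
  · simp [h, hu]
  · rfl

lemma wtBounded_LamInv {u : FSeq} : WtBounded u (LamInv u) :=
  wtBounded_of_symbol fun k => by
    unfold LamInv
    split_ifs with h
    · rw [norm_zero]; exact mul_nonneg (wt_pos k).le (norm_nonneg _)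
    · have h1 : (1 : ℝ) ≤ |(k : ℝ)| := by exact_mod_cast Int.one_le_abs h
      rw [norm_div, norm_cast_abs]
      refine (div_le_self (norm_nonneg _) h1).trans ?_
      exact le_mul_of_one_le_left (norm_nonneg _) (one_le_wt k)

/-- For `u` in `H²` every factor in the nonlinearity is square summable, so all the convolutions
converge and may be merged into a single sum with one symbol. -/
lemma IsH2Seq.hasSum_nonlin {u : FSeq} (hu : IsH2Seq u) (δ β : ℝ) (k : ℤ) :
    HasSum (fun n => nlsym δ β k n * (u n * u (k - n))) (nonlin δ β u k) := by
  have c1 := hu.hasSum_conv (wtBounded_self u) (wtBounded_dx u) k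
  have c2 := hu.hasSum_conv wtBounded_LamInv (wtBounded_self u) k
  have c3 := hu.hasSum_conv wtBounded_LamInv (wtBounded_self u).hilb k
  have c4 := hu.hasSum_conv wtBounded_LamInv (wtBounded_LamLam u) k
  have c5 := hu.hasSum_conv wtBounded_LamInv (wtBounded_LamLam u).hilb k
  have c6 := hu.hasSum_conv (wtBounded_self u) (wtBounded_dx u).hilb k
  have c7 := hu.hasSum_conv wtBounded_LamInv (wtBounded_dxdx u) k
  set s : ℂ := -Complex.I * ((Int.sign k : ℤ) : ℂ)
  set l : ℂ := ((|k| : ℤ) : ℂ)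
  set D : ℂ := Complex.I * (k : ℂ)
  have hsum := (((((c1.mul_left 2).add (((c2.mul_left s).sub c3).mul_left l)).add
    ((((c4.mul_left s).sub c5).mul_left l).mul_left (β : ℂ))).sub
    ((((c1.mul_left s).sub c6).mul_left l).mul_left (δ : ℂ))).add
    ((c1.mul_left D).mul_left (δ : ℂ))).add
    ((((((c2.mul_left D).mul_left D).sub c7).mul_left l)).mul_left (δ : ℂ))
  refine hsum.congr_fun fun n => ?_
  -- Zero mean makes `Λ⁻¹` a plain division by `|n|`, the mode `n = 0` being `0 / 0 = 0`.
  rw [LamInv_eq hu.zero]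
  unfold nlsym
  simp only [dx, ViscousWave.hilb, Lam, s, l, D]
  have habs : ((|k - n| : ℤ) : ℂ) * ((|k - n| : ℤ) : ℂ) = ((k - n : ℤ) : ℂ) ^ 2 := by
    rw [← Int.cast_mul, abs_mul_abs_self, sq, Int.cast_mul]
  have hIk : Complex.I * Complex.I = -1 := Complex.I_mul_I
  rw [Int.cast_sub (Int.sign k)]
  generalize ((k - n : ℤ) : ℂ) = m at *
  generalize ((|k - n| : ℤ) : ℂ) = m' at *
  linear_combination (β * ((|k| : ℤ) : ℂ) * Complex.I * (((Int.sign k : ℤ) : ℂ)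
    - ((Int.sign (k - n) : ℤ) : ℂ)) / ((|n| : ℤ) : ℂ) * u n * u (k - n)) * habs
    + (δ * ((|k| : ℤ) : ℂ) / ((|n| : ℤ) : ℂ) * (m ^ 2 - (k : ℂ) ^ 2) * u n * u (k - n)) * hIk

/-- `u uₓ` is a derivative, so its mean vanishes: the sum is odd under `n ↦ -n`. -/
lemma conv_dx_zero (u : FSeq) : conv u (dx u) 0 = 0 := by
  have h : conv u (dx u) 0 = -conv u (dx u) 0 := by
    conv_lhs => rw [conv, ← (Equiv.neg ℤ).tsum_eq]
    rw [conv, ← tsum_neg]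
    refine tsum_congr fun n => ?_
    simp only [Equiv.neg_apply, zero_sub, neg_neg, dx]
    push_cast
    ring
  exact self_eq_neg.mp h

lemma opN_eq (δ : ℝ) (u : FSeq) (k : ℤ) : opN δ u k = nsym δ k * u k := rfl

lemma opN_nonlin_zero (u : FSeq) (δ β : ℝ) :
    opN δ (nonlin δ β u) 0 = 0 := by
  rw [opN_eq]
  simp [nonlin, conv_dx_zero u, Lam, dx]

lemma IsH2Seq.hasSum_opN_nonlin {u : FSeq} (hu : IsH2Seq u) (δ β : ℝ) (k : ℤ) :
    HasSum (fun n => bilsym δ β k n * (u n * u (k - n))) (opN δ (nonlin δ β u) k) := by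
  by_cases hk : k = 0
  · subst hk
    rw [opN_nonlin_zero]
    refine hasSum_zero.congr_fun fun n => ?_
    simp [bilsym]
  · refine ((hu.hasSum_nonlin δ β k).mul_left (nsym δ k)).congr_fun fun n => ?_
    unfold bilsym
    split_ifs with h
    · rcases h with h | h | h
      · exact absurd h hk
      · simp [h, hu.zero]
      · simp [h, hu.zero]
    · ring

/-- `N` is the inverse of `1 + δ∂ₓ` and the differential operator is `∂ₓ(1 + δ∂ₓ)²`, so one factor
cancels; the Hilbert part is computed directly with `k sgn k = |k|`. -/
lemma rhs_linear_eq {ε : ℝ} (hε : 0 < ε) (δ β : ℝ) (k : ℤ) :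
    nsym δ k * (Complex.I * k + 2 * δ * (Complex.I * k) ^ 2 + -Complex.I * ((Int.sign k : ℤ) : ℂ)
      - β * (-Complex.I * ((Int.sign k : ℤ) : ℂ)) * (Complex.I * k) ^ 2
      + (δ : ℂ) ^ 2 * (Complex.I * k) ^ 3) = -(2 * ε) * linsym ε δ β k := by
  have hε' : (ε : ℂ) ≠ 0 := by exact_mod_cast hε.ne'
  have hI : Complex.I ^ 2 = -1 := Complex.I_sq
  have hn : nsym δ k * (1 + δ * (Complex.I * k)) = 1 := by
    rw [nsym, div_mul_eq_mul_div, div_eq_one_iff_eq (one_add_sq_ne δ k)]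
    linear_combination -(δ : ℂ) ^ 2 * (k : ℂ) ^ 2 * hI
  have hs : ((Int.sign k : ℤ) : ℂ) * k = ((|k| : ℤ) : ℂ) := by
    rw [← Int.cast_mul, Int.sign_mul_self_eq_abs]
  have e1 : nsym δ k * (Complex.I * k + 2 * δ * (Complex.I * k) ^ 2 + (δ : ℂ) ^ 2 * (Complex.I * k) ^ 3)
      = Complex.I * k - δ * (k : ℂ) ^ 2 := by
    linear_combination (Complex.I * k * (1 + δ * (Complex.I * k))) * hn + δ * (k : ℂ) ^ 2 * hI
  have e2 : nsym δ k * (-Complex.I * ((Int.sign k : ℤ) : ℂ)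
      - β * (-Complex.I * ((Int.sign k : ℤ) : ℂ)) * (Complex.I * k) ^ 2)
      = -(Complex.I * (Int.sign k : ℤ) * (1 + β * (k : ℂ) ^ 2) / (1 + δ ^ 2 * (k : ℂ) ^ 2)
        + δ * ((|k| : ℤ) : ℂ) * (1 + β * (k : ℂ) ^ 2) / (1 + δ ^ 2 * (k : ℂ) ^ 2)) := by
    rw [nsym, ← add_div, ← neg_div, div_mul_eq_mul_div, ← hs]
    congr 1
    linear_combination (δ * ((Int.sign k : ℤ) : ℂ) * k * (1 + β * (k : ℂ) ^ 2)
      + β * Complex.I * ((Int.sign k : ℤ) : ℂ) * (k : ℂ) ^ 2 * (1 - δ * Complex.I * k)) * hI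
  have e3 : -(2 * ε) * linsym ε δ β k = Complex.I * k - δ * (k : ℂ) ^ 2
      + -(Complex.I * (Int.sign k : ℤ) * (1 + β * (k : ℂ) ^ 2) / (1 + δ ^ 2 * (k : ℂ) ^ 2)
        + δ * ((|k| : ℤ) : ℂ) * (1 + β * (k : ℂ) ^ 2) / (1 + δ ^ 2 * (k : ℂ) ^ 2)) := by
    rw [linsym, neg_mul, mul_div_cancel₀ _ (mul_ne_zero two_ne_zero hε')]
    ring
  rw [e3, ← e1, ← e2]
  ring

/-- The equation in Fourier modes. -/
lemma IsH2Seq.rhs_eq {u : FSeq} (hu : IsH2Seq u) {ε : ℝ} (hε : 0 < ε) (δ β : ℝ) (k : ℤ) :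
    rhs ε δ β u k = (2 * ε) * (-linsym ε δ β k * u k
      + ∑' n, (-(1 / 2) * bilsym δ β k n) * (u n * u (k - n))) := by
  have h1 : ∑' n, (-(1 / 2) * bilsym δ β k n) * (u n * u (k - n))
      = -(1 / 2) * opN δ (nonlin δ β u) k := by
    rw [← (hu.hasSum_opN_nonlin δ β k).tsum_eq, ← tsum_mul_left]
    exact tsum_congr fun n => by ring
  rw [h1]
  simp only [rhs, Pi.add_apply, Pi.sub_apply, Pi.smul_apply, smul_eq_mul]
  simp only [opN_eq δ (dx u), opN_eq δ (dx (dx u)), opN_eq δ (hilb u), opN_eq δ (hilb (dx (dx u))),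
    opN_eq δ (dx (dx (dx u)))]
  simp only [dx, ViscousWave.hilb]
  linear_combination u k * rhs_linear_eq hε δ β k

/-! ### `L²` functions and their Fourier coefficients -/

lemma hat_eq_repr (f : L2C) : hat f = ⇑(fourierBasis (T := 2 * Real.pi).repr f) := by
  funext k; exact (fourierBasis_repr f k).symm

lemma hat_sub (f g : L2C) : hat (f - g) = hat f - hat g := by
  simp only [hat_eq_repr, map_sub]; rfl

lemma hat_smul (c : ℝ) (f : L2C) : hat (c • f) = fun k => (c : ℂ) * hat f k := by
  have h : c • f = (c : ℂ) • f := (Complex.coe_smul c f).symm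
  rw [h]
  simp only [hat_eq_repr, map_smul]; rfl

lemma hat_injective : Function.Injective hat := fun f g h => by
  rw [hat_eq_repr, hat_eq_repr] at h
  exact (fourierBasis (T := 2 * Real.pi)).repr.injective (lp.ext h)

lemma summable_hat (f : L2C) : Summable fun k => ‖hat f k‖ ^ 2 :=
  (hasSum_sq_fourierCoeff f).summable

lemma norm_sq_eq_tsum_hat (f : L2C) : ‖f‖ ^ 2 = ∑' k, ‖hat f k‖ ^ 2 := by
  rw [← (fourierBasis (T := 2 * Real.pi)).repr.norm_map f]
  have := lp.norm_rpow_eq_tsum (p := 2) (by norm_num) ((fourierBasis (T := 2 * Real.pi)).repr f)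
  rw [hat_eq_repr]
  simpa using this

/-- The `L²` function with given square summable Fourier coefficients. -/
def ofSeq (a : FSeq) (h : Summable fun k => ‖a k‖ ^ 2) : L2C :=
  (fourierBasis (T := 2 * Real.pi)).repr.symm ⟨a, ParabolicSystem.memℓp_of_summable_sq h⟩

@[simp] lemma hat_ofSeq (a : FSeq) (h : Summable fun k => ‖a k‖ ^ 2) : hat (ofSeq a h) = a := by
  rw [hat_eq_repr, ofSeq, LinearIsometryEquiv.apply_symm_apply]

lemma hat_zero_eq (f : L2C) : hat f 0 = ∫ x, (f : Circ → ℂ) x ∂(haarAddCircle : Measure Circ) := by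
  simp [hat, fourierCoeff]

lemma hat_star (f : L2C) (k : ℤ) : hat (star f) k = star (hat f (-k)) := by
  rw [hat, hat, fourierCoeff, fourierCoeff]
  have : star (∫ t, fourier (- -k) t • (f : Circ → ℂ) t ∂(haarAddCircle : Measure Circ))
      = ∫ t, star (fourier (- -k) t • (f : Circ → ℂ) t) ∂(haarAddCircle : Measure Circ) :=
    integral_conj.symm
  rw [this]
  refine integral_congr_ae ?_
  filter_upwards [Lp.coeFn_star f] with x hx
  rw [hx, Pi.star_apply, smul_eq_mul, smul_eq_mul, star_mul', fourier_neg (n := -k)]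
  simp

lemma realZeroMean_iff (f : L2C) :
    RealZeroMean f ↔ hat f 0 = 0 ∧ ∀ k, hat f (-k) = star (hat f k) := by
  have h1 : (∀ᵐ x ∂(haarAddCircle : Measure Circ), ((f : Circ → ℂ) x).im = 0) ↔ star f = f := by
    rw [Lp.ext_iff]
    constructor
    · intro h
      filter_upwards [h, Lp.coeFn_star f] with x hx hs
      rw [hs, Pi.star_apply]
      exact Complex.conj_eq_iff_im.mpr hx
    · intro h
      filter_upwards [h, Lp.coeFn_star f] with x hx hs
      rw [hs, Pi.star_apply] at hx
      exact Complex.conj_eq_iff_im.mp hx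
  have h2 : star f = f ↔ ∀ k, hat f (-k) = star (hat f k) := by
    rw [← hat_injective.eq_iff, funext_iff]
    simp only [hat_star]
    constructor
    · intro h k; rw [← h k, star_star]
    · intro h k; rw [h k, star_star]
  rw [RealZeroMean, h1, h2, hat_zero_eq, and_comm]

/-! ### Sobolev norms as weighted sums, and `L²` limits from limits of modes. -/

lemma rpow_two_wt (k : ℤ) (x : ℝ) : (1 + (k : ℝ) ^ 2) ^ (2 : ℝ) * x ^ 2 = (wt k * x) ^ 2 := by
  rw [Real.rpow_two, mul_pow]; rfl

lemma sobolevNorm_eq {s : ℝ} {f : L2C}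
    (h : Summable fun k : ℤ => (1 + (k : ℝ) ^ 2) ^ s * ‖hat f k‖ ^ 2) :
    sobolevNorm s f = ENNReal.ofReal √(∑' k : ℤ, (1 + (k : ℝ) ^ 2) ^ s * ‖hat f k‖ ^ 2) := by
  have h0 : ∀ k : ℤ, 0 ≤ (1 + (k : ℝ) ^ 2) ^ s * ‖hat f k‖ ^ 2 := fun k => by positivity
  rw [sobolevNorm, ← ENNReal.ofReal_tsum_of_nonneg h0 h,
    ENNReal.ofReal_rpow_of_nonneg (tsum_nonneg h0) (by norm_num), ← Real.sqrt_eq_rpow]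

lemma sobolevNorm_two_eq {f : L2C} (h : Summable fun k => (wt k * ‖hat f k‖) ^ 2) :
    sobolevNorm 2 f = ENNReal.ofReal √(∑' k, (wt k * ‖hat f k‖) ^ 2) := by
  simp only [← rpow_two_wt] at h ⊢
  exact sobolevNorm_eq h

lemma summable_of_sobolevNorm_lt_top {f : L2C} (h : sobolevNorm 2 f < ∞) :
    Summable fun k => (wt k * ‖hat f k‖) ^ 2 := by
  have h1 : ∑' k : ℤ, ENNReal.ofReal ((1 + (k : ℝ) ^ 2) ^ (2 : ℝ) * ‖hat f k‖ ^ 2) ≠ ∞ := by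
    intro h2
    rw [sobolevNorm, h2, ENNReal.top_rpow_of_pos (by norm_num)] at h
    exact lt_irrefl _ h
  simp only [rpow_two_wt] at h1
  refine (ENNReal.summable_toReal h1).congr fun k => ?_
  rw [ENNReal.toReal_ofReal (sq_nonneg _)]

lemma tsum_le_of_sobolevNorm_le {f : L2C} {r : ℝ} (hr : 0 ≤ r)
    (h : sobolevNorm 2 f ≤ ENNReal.ofReal r) :
    Summable (fun k => (wt k * ‖hat f k‖) ^ 2) ∧
      ∑' k, (wt k * ‖hat f k‖) ^ 2 ≤ r ^ 2 := by
  have hs := summable_of_sobolevNorm_lt_top (h.trans_lt ENNReal.ofReal_lt_top)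
  refine ⟨hs, ?_⟩
  rw [sobolevNorm_two_eq hs, ENNReal.ofReal_le_ofReal_iff hr] at h
  exact (Real.sqrt_le_left hr).mp h

/-- Parseval and dominated convergence for series. -/
lemma tendsto_norm_of_modes {F : Filter ℝ} {f : ℝ → L2C} {b : ℤ → ℝ}
    (hb : Summable fun k => b k ^ 2) (hbound : ∀ᶠ τ in F, ∀ k, ‖hat (f τ) k‖ ≤ b k)
    (hlim : ∀ k, Tendsto (fun τ => hat (f τ) k) F (𝓝 0)) : Tendsto f F (𝓝 0) := by
  have h := tendsto_tsum_of_dominated_convergence (f := fun τ k => ‖hat (f τ) k‖ ^ 2)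
    (g := fun _ => (0 : ℝ)) hb (fun k => by simpa using (hlim k).norm.pow 2) (by
      filter_upwards [hbound] with τ hτ k
      rw [norm_pow, norm_norm]
      exact pow_le_pow_left₀ (norm_nonneg _) (hτ k) 2)
  rw [tsum_zero] at h
  rw [tendsto_zero_iff_norm_tendsto_zero]
  have h2 := (Real.continuous_sqrt.tendsto 0).comp h
  rw [Real.sqrt_zero] at h2
  refine h2.congr fun τ => ?_
  rw [Function.comp, ← norm_sq_eq_tsum_hat, Real.sqrt_sq (norm_nonneg _)]

/-- Differentiability in `L²` from differentiability of the Fourier modes with a square summable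
bound on their derivatives. -/
lemma hasDerivWithinAt_of_modes {I : Set ℝ} (hI : Convex ℝ I) {f : ℝ → L2C} {g : ℝ → FSeq}
    {b : ℤ → ℝ} (hb : Summable fun k => b k ^ 2)
    (hderiv : ∀ k, ∀ t ∈ I, HasDerivWithinAt (fun τ => hat (f τ) k) (g t k) I t)
    (hbound : ∀ t ∈ I, ∀ k, ‖g t k‖ ≤ b k) {t : ℝ} (ht : t ∈ I) {v : L2C} (hv : hat v = g t) :
    HasDerivWithinAt f v I t := by
  rw [hasDerivWithinAt_iff_tendsto_slope, ← tendsto_sub_nhds_zero_iff]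
  have hb4 : Summable fun k => (2 * b k) ^ 2 := by
    simp only [mul_pow]; exact hb.mul_left _
  have hhat : ∀ τ k, hat (slope f t τ - v) k = slope (fun τ => hat (f τ) k) t τ - g t k := by
    intro τ k
    rw [hat_sub, hv, Pi.sub_apply, slope_def_module, hat_smul, hat_sub, slope_def_module]
    simp
  refine tendsto_norm_of_modes hb4 ?_ fun k => ?_
  · filter_upwards [self_mem_nhdsWithin] with τ hτ k
    have hne : |τ - t| ≠ 0 := abs_ne_zero.mpr (sub_ne_zero.mpr hτ.2)
    have hpos : 0 < |τ - t| := lt_of_le_of_ne (abs_nonneg _) hne.symm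
    -- The mean value inequality bounds all difference quotients of the mode `k` by `b k`, so `2 b
    -- k` dominates their distance to the derivative.
    have h1 := hI.norm_image_sub_le_of_norm_hasDerivWithin_le (hderiv k)
      (fun s hs => hbound s hs k) ht hτ.1
    rw [hhat, slope_def_module]
    refine (norm_sub_le _ _).trans ?_
    have h2 : ‖(τ - t)⁻¹ • (hat (f τ) k - hat (f t) k)‖ ≤ b k := by
      rw [norm_smul, norm_inv, Real.norm_eq_abs, inv_mul_le_iff₀ hpos, mul_comm]
      exact h1
    linarith [hbound t ht k]
  · simp only [hhat]
    rw [tendsto_sub_nhds_zero_iff]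
    exact (hasDerivWithinAt_iff_tendsto_slope.mp (hderiv k t ht))

lemma lintegral_exp_neg_eq {c : ℝ} (hc : 0 < c) :
    ∫⁻ t in Set.Ici (0 : ℝ), ENNReal.ofReal (Real.exp (-(c * t))) = ENNReal.ofReal (1 / c) := by
  have hi : IntegrableOn (fun t : ℝ => Real.exp (-(c * t))) (Set.Ici 0) := by
    rw [integrableOn_Ici_iff_integrableOn_Ioi]
    simpa using exp_neg_integrableOn_Ioi 0 hc
  rw [← ofReal_integral_eq_lintegral_ofReal hi (Eventually.of_forall fun t => Real.exp_nonneg _),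
    integral_Ici_eq_integral_Ioi]
  congr 1
  have := integral_exp_mul_Ioi (a := -c) (by linarith) 0
  simp only [neg_mul, mul_zero, Real.exp_zero] at this
  rw [this, neg_div_neg_eq]

namespace ParabolicSystem
namespace IsModeSolution

/-! ### From Fourier modes to strong solutions -/

variable {P : ParabolicSystem} {a₀ : FSeq} {r : ℝ} {u : ℤ → ℝ → ℂ} {V Q : ℤ → ℝ}

lemma wt_mul_norm_le (h : P.IsModeSolution a₀ r u V Q) (k : ℤ) {t : ℝ} (ht : 0 ≤ t) :
    wt k * ‖u k t‖ ≤ V k := by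
  refine (h.bound k t).trans (mul_le_of_le_one_left (h.V_nonneg k) ?_)
  rw [Real.exp_le_one_iff]
  have := mul_nonneg P.a_nonneg ht
  linarith

lemma norm_le (h : P.IsModeSolution a₀ r u V Q) (k : ℤ) {t : ℝ} (ht : 0 ≤ t) :
    ‖u k t‖ ≤ V k / wt k := by
  rw [le_div_iff₀ (wt_pos k), mul_comm]
  exact h.wt_mul_norm_le k ht

lemma summable_exp_V (h : P.IsModeSolution a₀ r u V Q) (t : ℝ) :
    Summable fun k => (Real.exp (-(P.a * t)) * V k) ^ 2 := by
  simp only [mul_pow]; exact h.summable_V.mul_left _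

lemma summable_wt (h : P.IsModeSolution a₀ r u V Q) (t : ℝ) :
    Summable fun k => (wt k * ‖u k t‖) ^ 2 :=
  (h.summable_exp_V t).of_nonneg_of_le (fun _ => sq_nonneg _) fun k =>
    pow_le_pow_left₀ (mul_nonneg (wt_pos k).le (norm_nonneg _)) (h.bound k t) 2

lemma isH2Seq (h : P.IsModeSolution a₀ r u V Q) (t : ℝ) : IsH2Seq fun k => u k t :=
  ⟨h.zero t, h.summable_wt t⟩

/-- The solution as an `L²`-valued function of time. -/
def toL2 (h : P.IsModeSolution a₀ r u V Q) (t : ℝ) : L2C :=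
  ofSeq (fun k => u k t) ((h.isH2Seq t).summable_sq (wtBounded_self _))

@[simp] lemma hat_toL2 (h : P.IsModeSolution a₀ r u V Q) (t : ℝ) :
    hat (h.toL2 t) = fun k => u k t := hat_ofSeq _ _

/-- The time derivatives of the modes. -/
def velocity (_ : P.IsModeSolution a₀ r u V Q) (t : ℝ) (k : ℤ) : ℂ :=
  -P.μ k * u k t + ∑' n, P.S k n * (u n t * u (k - n) t)

/-- The linear part costs the two derivatives available in `H²`; the quadratic part, with `br ≤ 2
wt`, is again a weighted convolution. The bound does not depend on time, as termwise differentiation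
in `L²` requires. -/
lemma norm_velocity_le (h : P.IsModeSolution a₀ r u V Q) {t : ℝ} (ht : 0 ≤ t) (k : ℤ) :
    ‖h.velocity t k‖ ≤ P.L * V k + 2 * P.K * wconv V V k := by
  have hL : 0 ≤ P.L := by
    have := (norm_nonneg _).trans (P.norm_μ_le 0)
    simpa [wt] using this
  refine (norm_add_le _ _).trans (add_le_add ?_ ?_)
  · rw [norm_mul, norm_neg]
    calc ‖P.μ k‖ * ‖u k t‖ ≤ P.L * wt k * ‖u k t‖ :=
          mul_le_mul_of_nonneg_right (P.norm_μ_le k) (norm_nonneg _)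
      _ = P.L * (wt k * ‖u k t‖) := by ring
      _ ≤ P.L * V k := mul_le_mul_of_nonneg_left (h.wt_mul_norm_le k ht) hL
  · have hs := (wconv_bound h.summable_V h.summable_V h.V_nonneg h.V_nonneg).1 k
    have hle : ∀ n, ‖P.S k n * (u n t * u (k - n) t)‖
        ≤ 2 * P.K * ((1 / wt n + 1 / wt (k - n)) * (V n * V (k - n))) := by
      intro n
      have hn := wt_pos n
      have hm := wt_pos (k - n)
      rw [norm_mul, norm_mul]
      calc ‖P.S k n‖ * (‖u n t‖ * ‖u (k - n) t‖)
          ≤ (P.K * (2 * wt n + 2 * wt (k - n))) * (V n / wt n * (V (k - n) / wt (k - n))) := by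
            refine mul_le_mul ((P.norm_S_le k n).trans ?_) (mul_le_mul (h.norm_le n ht)
              (h.norm_le _ ht) (norm_nonneg _) (div_nonneg (h.V_nonneg n) hn.le))
              (by positivity) (mul_nonneg P.K_nonneg (by positivity))
            exact mul_le_mul_of_nonneg_left (add_le_add (br_le_wt n) (br_le_wt _)) P.K_nonneg
        _ = _ := by field_simp; ring
    have hs' := hs.mul_left (2 * P.K)
    rw [wconv, ← tsum_mul_left]
    exact tsum_of_norm_bounded hs'.hasSum hle

lemma velocity_bound (h : P.IsModeSolution a₀ r u V Q) :
    Summable fun k => (P.L * V k + 2 * P.K * wconv V V k) ^ 2 := by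
  have h2 := (wconv_bound h.summable_V h.summable_V h.V_nonneg h.V_nonneg).2.1
  refine ((h.summable_V.mul_left (2 * P.L ^ 2)).add (h2.mul_left (8 * P.K ^ 2))).of_nonneg_of_le
    (fun _ => sq_nonneg _) fun k => ?_
  nlinarith [sq_nonneg (P.L * V k - 2 * P.K * wconv V V k)]

lemma hasDerivWithinAt_toL2 (h : P.IsModeSolution a₀ r u V Q) (hI : Convex ℝ P.I) {t : ℝ}
    (ht : t ∈ P.I) : ∃ v : L2C, HasDerivWithinAt h.toL2 v P.I t ∧ hat v = h.velocity t := by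
  have hle := fun k => h.norm_velocity_le (P.nonneg_of_mem t ht) k
  have hs : Summable fun k => ‖h.velocity t k‖ ^ 2 :=
    h.velocity_bound.of_nonneg_of_le (fun _ => sq_nonneg _) fun k =>
      pow_le_pow_left₀ (norm_nonneg _) (hle k) 2
  refine ⟨ofSeq _ hs, ?_, hat_ofSeq _ hs⟩
  refine hasDerivWithinAt_of_modes hI h.velocity_bound (g := h.velocity) (fun k t ht => ?_)
    (fun t ht => h.norm_velocity_le (P.nonneg_of_mem t ht)) ht (hat_ofSeq _ hs)
  simp only [hat_toL2]
  exact h.deriv k t ht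

/-- The majorant `2 V`, uniform in time and square summable, upgrades continuity of each mode to
continuity in `H²`. -/
lemma tendsto_sobolevNorm (h : P.IsModeSolution a₀ r u V Q) {t : ℝ} (ht : t ∈ P.I) :
    Tendsto (fun τ => sobolevNorm 2 (h.toL2 τ - h.toL2 t)) (𝓝[P.I] t) (𝓝 0) := by
  have hhat : ∀ τ k, hat (h.toL2 τ - h.toL2 t) k = u k τ - u k t := fun τ k => by
    rw [hat_sub]; simp
  have hle : ∀ τ ∈ P.I, ∀ k, (wt k * ‖u k τ - u k t‖) ^ 2 ≤ (2 * V k) ^ 2 := by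
    intro τ hτ k
    refine pow_le_pow_left₀ (mul_nonneg (wt_pos k).le (norm_nonneg _)) ?_ 2
    have := mul_le_mul_of_nonneg_left (norm_sub_le (u k τ) (u k t)) (wt_pos k).le
    linarith [h.wt_mul_norm_le k (P.nonneg_of_mem τ hτ), h.wt_mul_norm_le k (P.nonneg_of_mem t ht)]
  have hV : Summable fun k => (2 * V k) ^ 2 := by
    simp only [mul_pow]; exact h.summable_V.mul_left _
  have hlim := tendsto_tsum_of_dominated_convergence (𝓕 := 𝓝[P.I] t)
    (f := fun τ k => (wt k * ‖u k τ - u k t‖) ^ 2) (g := fun _ => (0 : ℝ)) hV (fun k => by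
      have hc : Tendsto (fun τ => (wt k * ‖u k τ - u k t‖) ^ 2) (𝓝[P.I] t)
          (𝓝 ((wt k * ‖u k t - u k t‖) ^ 2)) := by
        have := h.cont k
        exact (Continuous.tendsto (by fun_prop) t).mono_left nhdsWithin_le_nhds
      simpa using hc) (by
      filter_upwards [self_mem_nhdsWithin] with τ hτ k
      rw [Real.norm_of_nonneg (sq_nonneg _)]
      exact hle τ hτ k)
  rw [tsum_zero] at hlim
  have h2 := ENNReal.tendsto_ofReal ((Real.continuous_sqrt.tendsto 0).comp hlim)
  rw [Real.sqrt_zero, ENNReal.ofReal_zero] at h2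
  refine h2.congr' ?_
  filter_upwards [self_mem_nhdsWithin] with τ hτ
  have hs : Summable fun k => (wt k * ‖hat (h.toL2 τ - h.toL2 t) k‖) ^ 2 := by
    simp only [hhat]
    exact hV.of_nonneg_of_le (fun _ => sq_nonneg _) (hle τ hτ)
  rw [sobolevNorm_two_eq hs]
  simp only [hhat, Function.comp]

/-- The free part keeps its full heat decay, to be integrated in time; the Duhamel part is in `H³`
at each time because `Q k / br k` gains one derivative. -/
lemma H3_density_le (h : P.IsModeSolution a₀ r u V Q) (k : ℤ) {t : ℝ} (ht : t ∈ P.I) :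
    (1 + (k : ℝ) ^ 2) ^ (3 : ℝ) * ‖u k t‖ ^ 2 ≤
      2 * wt k * (wt k * ‖a₀ k‖) ^ 2 * Real.exp (-(2 * (P.η * wt k) * t))
        + 2 * Q k ^ 2 * Real.exp (-(2 * P.a * t)) := by
  have hw := wt_pos k
  have hb := br_pos k
  have ht0 := P.nonneg_of_mem t ht
  have e1 : (1 + (k : ℝ) ^ 2) ^ (3 : ℝ) * ‖u k t‖ ^ 2 = wt k * (wt k * ‖u k t‖) ^ 2 := by
    rw [show (3 : ℝ) = ((3 : ℕ) : ℝ) by norm_num, Real.rpow_natCast, wt]; ring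
  have e2 : Real.exp (-(2 * (P.η * wt k) * t)) = Real.exp (-(P.η * wt k * t)) ^ 2 := by
    rw [← Real.exp_nat_mul]; congr 1; push_cast; ring
  have e3 : Real.exp (-(2 * P.a * t)) = Real.exp (-(P.a * t)) ^ 2 := by
    rw [← Real.exp_nat_mul]; congr 1; push_cast; ring
  have hE : Real.exp (-(P.a * t)) ^ 2 ≤ 1 := by
    rw [← e3, Real.exp_le_one_iff]
    have := mul_nonneg P.a_nonneg ht0
    linarith
  rw [e1, e2, e3]
  set E := Real.exp (-(P.a * t))
  set G := Real.exp (-(P.η * wt k * t))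
  set A := wt k * ‖a₀ k‖
  have h1 := pow_le_pow_left₀ (mul_nonneg hw.le (norm_nonneg _)) (h.smoothing k t ht) 2
  have hq : wt k * (Q k / br k) ^ 2 ≤ Q k ^ 2 := by
    rw [div_pow, ← mul_div_assoc, div_le_iff₀ (by positivity), mul_comm]
    exact mul_le_mul_of_nonneg_left (wt_le_br_sq k) (sq_nonneg _)
  calc wt k * (wt k * ‖u k t‖) ^ 2 ≤ wt k * (E * (G * A + Q k / br k)) ^ 2 :=
        mul_le_mul_of_nonneg_left h1 hw.le
    _ = E ^ 2 * (wt k * (G * A + Q k / br k) ^ 2) := by ring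
    _ ≤ E ^ 2 * (wt k * (2 * (G * A) ^ 2 + 2 * (Q k / br k) ^ 2)) := by
        gcongr
        nlinarith [sq_nonneg (G * A - Q k / br k)]
    _ = E ^ 2 * (2 * wt k * A ^ 2 * G ^ 2) + 2 * (wt k * (Q k / br k) ^ 2) * E ^ 2 := by ring
    _ ≤ 1 * (2 * wt k * A ^ 2 * G ^ 2) + 2 * Q k ^ 2 * E ^ 2 := by gcongr
    _ = _ := by ring

lemma lintegral_H3_lt_top (h : P.IsModeSolution a₀ r u V Q) (hI : MeasurableSet P.I)
    (hint : ∫⁻ t in P.I, ENNReal.ofReal (Real.exp (-(2 * P.a * t))) < ∞)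
    (ha : Summable fun k => (wt k * ‖a₀ k‖) ^ 2) :
    ∫⁻ t in P.I, sobolevNorm 3 (h.toL2 t) ^ 2 < ∞ := by
  have hsub : P.I ⊆ Set.Ici 0 := fun t ht => P.nonneg_of_mem t ht
  have hsq : ∀ t, sobolevNorm 3 (h.toL2 t) ^ 2
      = ∑' k : ℤ, ENNReal.ofReal ((1 + (k : ℝ) ^ 2) ^ (3 : ℝ) * ‖u k t‖ ^ 2) := by
    intro t
    rw [sobolevNorm, ← ENNReal.rpow_natCast, ← ENNReal.rpow_mul]
    norm_num
  set f : ℤ → ℝ → ℝ≥0∞ := fun k t =>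
    ENNReal.ofReal (2 * wt k * (wt k * ‖a₀ k‖) ^ 2)
      * ENNReal.ofReal (Real.exp (-(2 * (P.η * wt k) * t)))
  set g : ℤ → ℝ → ℝ≥0∞ := fun k t =>
    ENNReal.ofReal (2 * Q k ^ 2) * ENNReal.ofReal (Real.exp (-(2 * P.a * t)))
  have hf : ∀ k, Measurable (f k) := fun k => by fun_prop
  have hg : ∀ k, Measurable (g k) := fun k => by fun_prop
  have hle : ∀ t ∈ P.I, sobolevNorm 3 (h.toL2 t) ^ 2 ≤ ∑' k, f k t + ∑' k, g k t := by
    intro t ht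
    rw [hsq, ← ENNReal.tsum_add]
    refine ENNReal.tsum_le_tsum fun k => ?_
    have hw := wt_pos k
    refine (ENNReal.ofReal_le_ofReal (h.H3_density_le k ht)).trans ?_
    rw [ENNReal.ofReal_add (by positivity) (by positivity),
      ENNReal.ofReal_mul (p := 2 * wt k * (wt k * ‖a₀ k‖) ^ 2) (by positivity),
      ENNReal.ofReal_mul (p := 2 * Q k ^ 2) (by positivity)]
  refine (setLIntegral_mono' hI hle).trans_lt ?_
  rw [lintegral_add_left (Measurable.tsum hf), lintegral_tsum fun k => (hf k).aemeasurable,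
    lintegral_tsum fun k => (hg k).aemeasurable]
  refine ENNReal.add_lt_top.mpr ⟨?_, ?_⟩
  -- Integrating `e^{-2η wt(k) t}` in time gives `1 / (2η wt k)`, which cancels the extra weight of
  -- `H³`.
  · have hfk : ∀ k, ∫⁻ t in P.I, f k t ≤ ENNReal.ofReal (1 / P.η * (wt k * ‖a₀ k‖) ^ 2) := by
      intro k
      have hw := wt_pos k
      have hη := P.η_pos
      refine (lintegral_mono_set hsub).trans ?_
      rw [lintegral_const_mul _ (by fun_prop), lintegral_exp_neg_eq (by positivity),
        ← ENNReal.ofReal_mul (by positivity)]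
      refine ENNReal.ofReal_le_ofReal (le_of_eq ?_)
      field_simp
    refine (ENNReal.tsum_le_tsum hfk).trans_lt ?_
    have hη := P.η_pos
    rw [← ENNReal.ofReal_tsum_of_nonneg (fun k => by positivity) (ha.mul_left _)]
    exact ENNReal.ofReal_lt_top
  · have hgk : ∀ k, ∫⁻ t in P.I, g k t = ENNReal.ofReal (2 * Q k ^ 2)
        * ∫⁻ t in P.I, ENNReal.ofReal (Real.exp (-(2 * P.a * t))) := fun k =>
      lintegral_const_mul _ (by fun_prop)
    simp only [hgk]
    rw [ENNReal.tsum_mul_right,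
      ← ENNReal.ofReal_tsum_of_nonneg (fun k => by positivity) (h.summable_Q.mul_left _)]
    exact ENNReal.mul_lt_top ENNReal.ofReal_lt_top hint

lemma realZeroMean_toL2 (h : P.IsModeSolution a₀ r u V Q) (t : ℝ) : RealZeroMean (h.toL2 t) := by
  rw [realZeroMean_iff]
  simp only [hat_toL2]
  exact ⟨h.zero t, fun k => h.neg k t⟩

lemma sobolevNorm_le (h : P.IsModeSolution a₀ r u V Q) (hr : 0 ≤ r) {s : ℝ} (hs : s ≤ 2) (t : ℝ) :
    sobolevNorm s (h.toL2 t) ≤ ENNReal.ofReal (2 * r * Real.exp (-(P.a * t))) := by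
  have hle : ∀ k : ℤ, (1 + (k : ℝ) ^ 2) ^ s * ‖hat (h.toL2 t) k‖ ^ 2
      ≤ Real.exp (-(P.a * t)) ^ 2 * V k ^ 2 := by
    intro k
    rw [hat_toL2, ← mul_pow]
    refine le_trans ?_ (pow_le_pow_left₀ (mul_nonneg (wt_pos k).le (norm_nonneg _)) (h.bound k t) 2)
    rw [← rpow_two_wt]
    exact mul_le_mul_of_nonneg_right (Real.rpow_le_rpow_of_exponent_le (one_le_wt k) hs)
      (sq_nonneg _)
  have hsum := (h.summable_V.mul_left (Real.exp (-(P.a * t)) ^ 2)).of_nonneg_of_le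
    (fun k => by positivity) hle
  rw [sobolevNorm_eq hsum]
  refine ENNReal.ofReal_le_ofReal ((Real.sqrt_le_left (by positivity)).mpr ?_)
  refine (hsum.tsum_le_tsum hle (h.summable_V.mul_left _)).trans ?_
  rw [tsum_mul_left, mul_pow, mul_comm]
  exact mul_le_mul_of_nonneg_right h.tsum_V_le (sq_nonneg _)

/-- `H²` embeds in the Wiener algebra by Cauchy–Schwarz against `1 / wt`. -/
lemma wienerNorm_le (h : P.IsModeSolution a₀ r u V Q) (hr : 0 ≤ r) (t : ℝ) :
    wienerNorm (h.toL2 t) ≤ ENNReal.ofReal (convConst * r * Real.exp (-(P.a * t))) := by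
  have hle : ∀ k, ‖hat (h.toL2 t) k‖ ≤ Real.exp (-(P.a * t)) * (V k / wt k) := by
    intro k
    rw [hat_toL2, ← mul_div_assoc, le_div_iff₀ (wt_pos k), mul_comm]
    exact h.bound k t
  have hV := summable_div_wt h.summable_V
  have hsum := (hV.mul_left (Real.exp (-(P.a * t)))).of_nonneg_of_le (fun k => norm_nonneg _) hle
  rw [wienerNorm, ← ENNReal.ofReal_tsum_of_nonneg (fun k => norm_nonneg _) hsum]
  refine ENNReal.ofReal_le_ofReal ((hsum.tsum_le_tsum hle (hV.mul_left _)).trans ?_)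
  rw [tsum_mul_left, mul_comm]
  refine mul_le_mul_of_nonneg_right ?_ (Real.exp_nonneg _)
  refine abs_le_of_sq_le_sq' ?_ (mul_nonneg convConst_nonneg hr) |>.2
  refine (tsum_div_wt_sq_le h.summable_V).trans ?_
  have hW : 0 ≤ ∑' n, (1 / wt n) ^ 2 := tsum_nonneg fun n => sq_nonneg _
  rw [convConst, mul_pow, mul_pow, Real.sq_sqrt hW]
  have := mul_le_mul_of_nonneg_right h.tsum_V_le hW
  linarith

/-- A mode solution of the system with the symbols of the equation is a strong solution. -/
theorem isStrongSolution {u₀ : L2C} (h : P.IsModeSolution (hat u₀) r u V Q) {ε δ β : ℝ}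
    (hε : 0 < ε) (hμ : ∀ k ≠ 0, P.μ k = linsym ε δ β k)
    (hS : ∀ k n, P.S k n = -(1 / 2) * bilsym δ β k n) (hI : Convex ℝ P.I)
    (hmeas : MeasurableSet P.I)
    (hint : ∫⁻ t in P.I, ENNReal.ofReal (Real.exp (-(2 * P.a * t))) < ∞)
    (ha : Summable fun k => (wt k * ‖hat u₀ k‖) ^ 2) :
    IsStrongSolution ε δ β P.I u₀ h.toL2 where
  initial := hat_injective (by rw [hat_toL2]; exact funext h.init)
  realZeroMean t _ := h.realZeroMean_toL2 t
  mem_H2 t _ := by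
    have hs : Summable fun k => (wt k * ‖hat (h.toL2 t) k‖) ^ 2 := by
      simp only [hat_toL2]; exact h.summable_wt t
    rw [sobolevNorm_two_eq hs]
    exact ENNReal.ofReal_lt_top
  continuous_H2 t ht := h.tendsto_sobolevNorm ht
  sq_integrable_H3 := h.lintegral_H3_lt_top hmeas hint ha
  equation t ht := by
    obtain ⟨v, hv, hhat⟩ := h.hasDerivWithinAt_toL2 hI ht
    refine ⟨v, hv, ?_⟩
    funext k
    rw [hat_toL2, (h.isH2Seq t).rhs_eq hε, hhat, Pi.smul_apply, smul_eq_mul, velocity]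
    simp only [hS]
    by_cases hk : k = 0
    · subst hk; simp [h.zero]
    · rw [hμ k hk]

end IsModeSolution
end ParabolicSystem

/-! ### Uniqueness -/

lemma IsStrongSolution.mono {ε δ β : ℝ} {I J : Set ℝ} {u₀ : L2C} {u : ℝ → L2C}
    (hu : IsStrongSolution ε δ β I u₀ u) (hJ : J ⊆ I) : IsStrongSolution ε δ β J u₀ u where
  initial := hu.initial
  realZeroMean t ht := hu.realZeroMean t (hJ ht)
  mem_H2 t ht := hu.mem_H2 t (hJ ht)
  continuous_H2 t ht := (hu.continuous_H2 t (hJ ht)).mono_left (nhdsWithin_mono t hJ)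
  sq_integrable_H3 := (lintegral_mono_set hJ).trans_lt hu.sq_integrable_H3
  equation t ht := by
    obtain ⟨v, hv, he⟩ := hu.equation t (hJ ht)
    exact ⟨v, hv.mono hJ, he⟩

lemma IsStrongSolution.isH2Seq {ε δ β : ℝ} {I : Set ℝ} {u₀ : L2C} {u : ℝ → L2C}
    (hu : IsStrongSolution ε δ β I u₀ u) {t : ℝ} (ht : t ∈ I) : IsH2Seq (hat (u t)) :=
  ⟨((realZeroMean_iff _).mp (hu.realZeroMean t ht)).1,
    summable_of_sobolevNorm_lt_top (hu.mem_H2 t ht)⟩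

lemma tsum_wt_sq_le_of_sub {f g : FSeq} (hf : Summable fun k => (wt k * ‖f k‖) ^ 2)
    (hfg : Summable fun k => (wt k * ‖(f - g) k‖) ^ 2)
    (hg : Summable fun k => (wt k * ‖g k‖) ^ 2) :
    ∑' k, (wt k * ‖f k‖) ^ 2
      ≤ 2 * ∑' k, (wt k * ‖(f - g) k‖) ^ 2 + 2 * ∑' k, (wt k * ‖g k‖) ^ 2 := by
  rw [← tsum_mul_left, ← tsum_mul_left, ← (hfg.mul_left 2).tsum_add (hg.mul_left 2)]
  refine hf.tsum_le_tsum (fun k => ?_) ((hfg.mul_left 2).add (hg.mul_left 2))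
  have h1 : ‖f k‖ ≤ ‖(f - g) k‖ + ‖g k‖ := by
    have := norm_add_le ((f - g) k) (g k)
    rwa [Pi.sub_apply, sub_add_cancel] at this
  have h2 := mul_le_mul_of_nonneg_left h1 (wt_pos k).le
  have h3 := pow_le_pow_left₀ (mul_nonneg (wt_pos k).le (norm_nonneg _)) h2 2
  nlinarith [sq_nonneg (wt k * ‖(f - g) k‖ - wt k * ‖g k‖)]

/-- Continuity in `H²` gives a bound near each time; compactness makes it uniform. -/
lemma IsStrongSolution.exists_bound {ε δ β : ℝ} {I : Set ℝ} {u₀ : L2C} {u : ℝ → L2C}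
    (hu : IsStrongSolution ε δ β I u₀ u) (hI : IsCompact I) :
    ∃ A : ℝ, ∀ t ∈ I, ∑' k, (wt k * ‖hat (u t) k‖) ^ 2 ≤ A := by
  have key : ∃ A : ℝ, ∀ t ∈ I, t ∈ I → ∑' k, (wt k * ‖hat (u t) k‖) ^ 2 ≤ A := by
    refine hI.induction_on (p := fun s => ∃ A : ℝ, ∀ t ∈ s, t ∈ I →
      ∑' k, (wt k * ‖hat (u t) k‖) ^ 2 ≤ A) ⟨0, by simp⟩ ?_ ?_ ?_
    · rintro s t hst ⟨A, hA⟩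
      exact ⟨A, fun τ hτ => hA τ (hst hτ)⟩
    · rintro s t ⟨A, hA⟩ ⟨B, hB⟩
      refine ⟨max A B, fun τ hτ hτI => ?_⟩
      rcases hτ with hτ | hτ
      · exact (hA τ hτ hτI).trans (le_max_left _ _)
      · exact (hB τ hτ hτI).trans (le_max_right _ _)
    · intro t ht
      refine ⟨{τ | sobolevNorm 2 (u τ - u t) < 1},
        (hu.continuous_H2 t ht).eventually_lt_const one_pos,
        2 * 1 ^ 2 + 2 * ∑' k, (wt k * ‖hat (u t) k‖) ^ 2, fun τ hτ hτI => ?_⟩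
      obtain ⟨h1, h2⟩ := tsum_le_of_sobolevNorm_le zero_le_one
        ((le_of_lt hτ).trans_eq ENNReal.ofReal_one.symm)
      rw [hat_sub] at h1 h2
      refine (tsum_wt_sq_le_of_sub (hu.isH2Seq hτI).summable h1 (hu.isH2Seq ht).summable).trans ?_
      linarith
  obtain ⟨A, hA⟩ := key
  exact ⟨A, fun t ht => hA t ht ht⟩

lemma inner_eq_tsum_hat (f g : L2C) :
    HasSum (fun k => (star (hat f k) * hat g k).re) (inner ℝ f g) := by
  have hfg := summable_hat (f + g)
  have hadd : hat (f + g) = hat f + hat g := by simp only [hat_eq_repr, map_add]; rfl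
  rw [real_inner_eq_norm_add_mul_self_sub_norm_mul_self_sub_norm_mul_self_div_two,
    ← sq, ← sq, ← sq, norm_sq_eq_tsum_hat, norm_sq_eq_tsum_hat f, norm_sq_eq_tsum_hat g]
  refine (((hfg.hasSum.sub (summable_hat f).hasSum).sub
    (summable_hat g).hasSum).div_const 2).congr_fun fun k => ?_
  rw [hadd, Pi.add_apply]
  simp only [← Complex.normSq_eq_norm_sq, Complex.normSq_apply, Complex.add_re, Complex.add_im,
    Complex.mul_re, Complex.star_def, Complex.conj_re, Complex.conj_im]
  ring

/-- Gronwall: `E e^{-Γt}` is nonincreasing, nonnegative and starts at zero. -/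
lemma eq_zero_of_deriv_le_mul {T Γ : ℝ} {E E' : ℝ → ℝ}
    (hE : ∀ t ∈ Set.Icc 0 T, HasDerivWithinAt E (E' t) (Set.Icc 0 T) t)
    (hle : ∀ t ∈ Set.Icc 0 T, E' t ≤ Γ * E t) (h0 : E 0 = 0) (hnonneg : ∀ t, 0 ≤ E t) :
    ∀ t ∈ Set.Icc 0 T, E t = 0 := by
  have hd : ∀ t ∈ Set.Icc 0 T, HasDerivWithinAt (fun t => E t * Real.exp (-(Γ * t)))
      (E' t * Real.exp (-(Γ * t)) + E t * (Real.exp (-(Γ * t)) * -Γ)) (Set.Icc 0 T) t := by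
    intro t ht
    have h1 : HasDerivAt (fun s => -(Γ * s)) (-Γ) t := by
      simpa using ((hasDerivAt_id t).const_mul Γ).fun_neg
    exact (hE t ht).mul h1.exp.hasDerivWithinAt
  have hanti : AntitoneOn (fun t => E t * Real.exp (-(Γ * t))) (Set.Icc 0 T) := by
    refine antitoneOn_of_hasDerivWithinAt_nonpos (convex_Icc 0 T)
      (fun t ht => (hd t ht).continuousWithinAt)
      (fun t ht => (hd t (interior_subset ht)).mono interior_subset) fun t ht => ?_
    have h1 := mul_le_mul_of_nonneg_right (hle t (interior_subset ht))
      (Real.exp_nonneg (-(Γ * t)))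
    linarith
  intro t ht
  have h := hanti (Set.left_mem_Icc.mpr (ht.1.trans ht.2)) ht ht.1
  simp only [h0, zero_mul] at h
  exact le_antisymm (nonpos_of_mul_nonpos_left h (Real.exp_pos _)) (hnonneg t)

/-- Estimate of the difference of two quadratic terms by a convolution, losing one derivative. -/
lemma norm_quad_diff_le {S : ℤ → ℤ → ℂ} {K : ℝ} (hK : 0 ≤ K)
    (hS : ∀ k n, ‖S k n‖ ≤ K * (br n + br (k - n))) {a b : FSeq} (ha : IsH2Seq a) (hb : IsH2Seq b)
    (hsa : ∀ k, Summable fun n => S k n * (a n * a (k - n)))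
    (hsb : ∀ k, Summable fun n => S k n * (b n * b (k - n)))
    (hU : Summable fun m => br m * (‖a m‖ + ‖b m‖)) (k : ℤ) :
    ‖∑' n, S k n * (a n * a (k - n)) - ∑' n, S k n * (b n * b (k - n))‖
      ≤ 3 * K * br k * ∑' n, ‖(a - b) n‖ * (br (k - n) * (‖a (k - n)‖ + ‖b (k - n)‖)) := by
  have hd : Summable fun n => ‖(a - b) n‖ ^ 2 := by
    refine (((ha.summable_sq (wtBounded_self a)).mul_left 2).add
      ((hb.summable_sq (wtBounded_self b)).mul_left 2)).of_nonneg_of_le (fun _ => sq_nonneg _)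
      fun n => ?_
    have := pow_le_pow_left₀ (norm_nonneg _) (norm_sub_le (a n) (b n)) 2
    rw [Pi.sub_apply]
    nlinarith [sq_nonneg (‖a n‖ - ‖b n‖)]
  have hH := (young_l2_l1 hd hU fun m =>
    mul_nonneg (br_pos m).le (add_nonneg (norm_nonneg _) (norm_nonneg _))).1 k
  set H : ℤ → ℝ := fun n => ‖(a - b) n‖ * (br (k - n) * (‖a (k - n)‖ + ‖b (k - n)‖))
  set F : ℤ → ℝ := fun n => (br n + br (k - n)) * (‖(a - b) n‖ * ‖a (k - n)‖)
  set G : ℤ → ℝ := fun n => (br n + br (k - n)) * (‖(a - b) n‖ * ‖b (k - n)‖)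
  -- The derivative is moved off the difference `a - b`, of which only the `L²` norm is controlled,
  -- onto the output frequency and the solutions.
  have hbr : ∀ n, br n + br (k - n) ≤ 3 * br k * br (k - n) := by
    intro n
    have h1 := br_le_add n k
    have h2 : br (n - k) = br (k - n) := by
      unfold br; push_cast; rw [abs_sub_comm]
    rw [h2] at h1
    nlinarith [one_le_br k, one_le_br (k - n),
      mul_nonneg (sub_nonneg.mpr (one_le_br k)) (sub_nonneg.mpr (one_le_br (k - n)))]
  have hbr0 : ∀ n, 0 ≤ br n + br (k - n) := fun n => add_nonneg (br_pos n).le (br_pos _).le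
  have hF0 : ∀ n, 0 ≤ F n := fun n =>
    mul_nonneg (hbr0 n) (mul_nonneg (norm_nonneg _) (norm_nonneg _))
  have hG0 : ∀ n, 0 ≤ G n := fun n =>
    mul_nonneg (hbr0 n) (mul_nonneg (norm_nonneg _) (norm_nonneg _))
  have hFG : ∀ n, F n + G n ≤ 3 * br k * H n := by
    intro n
    have := mul_le_mul_of_nonneg_right (hbr n)
      (mul_nonneg (norm_nonneg ((a - b) n)) (add_nonneg (norm_nonneg (a (k - n)))
        (norm_nonneg (b (k - n)))))
    simp only [F, G, H]
    linarith
  have hH' := hH.mul_left (3 * br k)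
  have hF : Summable F := hH'.of_nonneg_of_le hF0 fun n => by linarith [hFG n, hG0 n]
  have hG : Summable G := hH'.of_nonneg_of_le hG0 fun n => by linarith [hFG n, hF0 n]
  -- In `b n (a - b)(k - n)` the difference sits at `k - n`; reflecting the sum brings it to `n`.
  have hGr : Summable fun n => G (k - n) := (Equiv.subLeft k).summable_iff.mpr hG
  have hle : ∀ n, ‖S k n * (a n * a (k - n)) - S k n * (b n * b (k - n))‖
      ≤ K * (F n + G (k - n)) := by
    intro n
    have e : S k n * (a n * a (k - n)) - S k n * (b n * b (k - n))
        = S k n * ((a - b) n * a (k - n) + b n * (a - b) (k - n)) := by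
      simp only [Pi.sub_apply]; ring
    rw [e, norm_mul]
    have h1 : ‖(a - b) n * a (k - n) + b n * (a - b) (k - n)‖
        ≤ ‖(a - b) n‖ * ‖a (k - n)‖ + ‖b n‖ * ‖(a - b) (k - n)‖ :=
      (norm_add_le _ _).trans_eq (by rw [norm_mul, norm_mul])
    refine (mul_le_mul (hS k n) h1 (norm_nonneg _) (mul_nonneg hK (hbr0 n))).trans (le_of_eq ?_)
    simp only [F, G, sub_sub_cancel]
    ring
  rw [← (hsa k).tsum_sub (hsb k)]
  refine (tsum_of_norm_bounded ((hF.add hGr).mul_left K).hasSum hle).trans ?_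
  have hflip : ∑' n, G (k - n) = ∑' n, G n := (Equiv.subLeft k).tsum_eq G
  rw [tsum_mul_left, hF.tsum_add hGr, hflip, ← hF.tsum_add hG]
  have h3 := (hF.add hG).tsum_le_tsum hFG hH'
  rw [tsum_mul_left] at h3
  have h4 := mul_le_mul_of_nonneg_left h3 hK
  linarith

/-- One derivative of an `H²` function is in the Wiener algebra: Cauchy–Schwarz with `br = (br / wt)
· wt`, where `(br / wt)²` is at most `2 / wt` and hence summable. -/
lemma summable_br_mul {a b : FSeq} (ha : IsH2Seq a) (hb : IsH2Seq b) {A : ℝ}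
    (haA : ∑' k, (wt k * ‖a k‖) ^ 2 ≤ A) (hbA : ∑' k, (wt k * ‖b k‖) ^ 2 ≤ A) :
    Summable (fun m => br m * (‖a m‖ + ‖b m‖)) ∧
      (∑' m, br m * (‖a m‖ + ‖b m‖)) ^ 2 ≤ 8 * (∑' k, 1 / wt k) * A := by
  have hle1 : ∀ k, (br k / wt k) ^ 2 ≤ 2 * (1 / wt k) := fun k => by
    have hw := wt_pos k
    rw [div_pow, div_le_iff₀ (by positivity)]
    have : 2 * (1 / wt k) * wt k ^ 2 = 2 * wt k := by field_simp
    rw [this]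
    exact br_sq_le k
  have hle2 : ∀ k, (wt k * (‖a k‖ + ‖b k‖)) ^ 2
      ≤ 2 * (wt k * ‖a k‖) ^ 2 + 2 * (wt k * ‖b k‖) ^ 2 := fun k => by
    nlinarith [sq_nonneg (wt k * ‖a k‖ - wt k * ‖b k‖)]
  have hs1' := summable_inv_wt.mul_left 2
  have hs2' := (ha.summable.mul_left 2).add (hb.summable.mul_left 2)
  have hs1 := hs1'.of_nonneg_of_le (fun k => sq_nonneg (br k / wt k)) hle1
  have hs2 := hs2'.of_nonneg_of_le (fun k => sq_nonneg (wt k * (‖a k‖ + ‖b k‖))) hle2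
  have hmul : ∀ k, br k / wt k * (wt k * (‖a k‖ + ‖b k‖)) = br k * (‖a k‖ + ‖b k‖) := fun k => by
    have hw := (wt_pos k).ne'
    field_simp
  refine ⟨(summable_mul_of_sq hs1 hs2).congr hmul, ?_⟩
  have h := tsum_mul_sq_le hs1 hs2
  simp only [hmul] at h
  have h1 := hs1.tsum_le_tsum hle1 hs1'
  have h2 := hs2.tsum_le_tsum hle2 hs2'
  rw [tsum_mul_left] at h1
  rw [(ha.summable.mul_left 2).tsum_add (hb.summable.mul_left 2), tsum_mul_left,
    tsum_mul_left] at h2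
  have hW : 0 ≤ ∑' k, 1 / wt k := tsum_nonneg fun k => one_div_nonneg.mpr (wt_pos k).le
  have h3 : ∑' k, (wt k * (‖a k‖ + ‖b k‖)) ^ 2 ≤ 4 * A := by linarith
  refine h.trans ((mul_le_mul h1 h3 (tsum_nonneg fun k => sq_nonneg _) (by positivity)).trans ?_)
  linarith

/-- The energy inequality for the difference of two solutions. -/
lemma energy_le {ε δ β A : ℝ} (hε : 0 < ε) (hδ : 0 < δ) (hβ : 0 ≤ β) {f g v w : L2C}
    (hf : IsH2Seq (hat f)) (hg : IsH2Seq (hat g))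
    (hfA : ∑' k, (wt k * ‖hat f k‖) ^ 2 ≤ A) (hgA : ∑' k, (wt k * ‖hat g k‖) ^ 2 ≤ A)
    (hv : (2 * ε : ℂ) • hat v = rhs ε δ β (hat f)) (hw : (2 * ε : ℂ) • hat w = rhs ε δ β (hat g)) :
    inner ℝ (f - g) (v - w) ≤ 9 * bilConst δ β ^ 2 / (δ / (2 * ε))
      * (8 * (∑' k, 1 / wt k) * A) * ‖f - g‖ ^ 2 := by
  set a := hat f
  set b := hat g
  set K := bilConst δ β
  set c := δ / (2 * ε)
  have hcpos : 0 < c := by positivity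
  have hK : 0 ≤ K := bilConst_nonneg hδ hβ
  have hε2 : (2 * ε : ℂ) ≠ 0 := by
    have : (ε : ℂ) ≠ 0 := by exact_mod_cast hε.ne'
    exact mul_ne_zero two_ne_zero this
  set S : ℤ → ℤ → ℂ := fun k n => -(1 / 2) * bilsym δ β k n
  have hS : ∀ k n, ‖S k n‖ ≤ K * (br n + br (k - n)) := by
    intro k n
    refine le_trans ?_ (norm_bilsym_le hδ hβ k n)
    simp only [S]
    rw [norm_mul]
    refine mul_le_of_le_one_left (norm_nonneg _) ?_
    norm_num
  have hsum : ∀ {a : FSeq}, IsH2Seq a → ∀ k, Summable fun n => S k n * (a n * a (k - n)) :=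
    fun h k => ((h.hasSum_opN_nonlin δ β k).summable.mul_left (-(1 / 2))).congr fun n => by
      simp only [S]; ring
  obtain ⟨hU, hUA⟩ := summable_br_mul hf hg hfA hgA
  set U : ℤ → ℝ := fun m => br m * (‖a m‖ + ‖b m‖)
  have hU0 : ∀ m, 0 ≤ U m := fun m =>
    mul_nonneg (br_pos m).le (add_nonneg (norm_nonneg _) (norm_nonneg _))
  have hd : Summable fun n => ‖(a - b) n‖ ^ 2 := by
    rw [← hat_sub]; exact summable_hat (f - g)
  obtain ⟨-, hz, hzle⟩ := young_l2_l1 hd hU hU0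
  set z : ℤ → ℝ := fun k => ∑' n, ‖(a - b) n‖ * U (k - n)
  have hvel : ∀ {v : L2C} {a : FSeq}, IsH2Seq a → (2 * ε : ℂ) • hat v = rhs ε δ β a →
      ∀ k, hat v k = -linsym ε δ β k * a k + ∑' n, S k n * (a n * a (k - n)) := by
    intro v a ha hva k
    have h := congrFun hva k
    rw [ha.rhs_eq hε, Pi.smul_apply, smul_eq_mul] at h
    exact mul_left_cancel₀ hε2 h
  have hmode : ∀ k, (star (hat (f - g) k) * hat (v - w) k).re ≤ 9 * K ^ 2 / c * z k ^ 2 := by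
    intro k
    have hq := norm_quad_diff_le hK hS hf hg (hsum hf) (hsum hg) hU k
    set q := ∑' n, S k n * (a n * a (k - n)) - ∑' n, S k n * (b n * b (k - n)) with hqdef
    have e1 : hat (v - w) k = -linsym ε δ β k * (a - b) k + q := by
      rw [hat_sub, Pi.sub_apply, hvel hf hv, hvel hg hw, hqdef, Pi.sub_apply]
      ring
    rw [e1, hat_sub]
    change (star ((a - b) k) * _).re ≤ _
    have hz0 : 0 ≤ 9 * K ^ 2 / c * z k ^ 2 := by positivity
    by_cases hk : k = 0
    · have : (a - b) k = 0 := by rw [hk, Pi.sub_apply, hf.zero, hg.zero, sub_zero]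
      rw [this]
      simpa using hz0
    set d := (a - b) k
    have e2 : (star d * (-linsym ε δ β k * d + q)).re
        = -((linsym ε δ β k).re * ‖d‖ ^ 2) + (star d * q).re := by
      rw [← Complex.normSq_eq_norm_sq, Complex.normSq_apply]
      simp only [Complex.mul_re, Complex.add_re, Complex.add_im, Complex.mul_im, Complex.neg_re,
        Complex.neg_im, Complex.star_def, Complex.conj_re, Complex.conj_im]
      ring
    have e3 : (star d * q).re ≤ ‖d‖ * (3 * K * br k * z k) := by
      refine (Complex.re_le_norm _).trans ?_
      rw [norm_mul, norm_star]
      exact mul_le_mul_of_nonneg_left hq (norm_nonneg _)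
    have hk1 : (1 : ℝ) ≤ |(k : ℝ)| := by exact_mod_cast Int.one_le_abs hk
    -- The factor `4` matches the `1/4` in the weighted Young inequality below, so the damping `c
    -- k²` absorbs the whole derivative term.
    have hbr : br k ^ 2 ≤ 4 * (k : ℝ) ^ 2 := by
      unfold br; rw [← sq_abs (k : ℝ)]; nlinarith
    have e4 := mul_le_mul_of_nonneg_right (le_re_linsym hε hδ hβ k) (sq_nonneg ‖d‖)
    have e5 := mul_le_mul_of_nonneg_right (mul_le_mul_of_nonneg_left hbr hcpos.le)
      (sq_nonneg ‖d‖)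
    have e6 : ‖d‖ * (3 * K * br k * z k) ≤ c * br k ^ 2 * ‖d‖ ^ 2 / 4 + 9 * K ^ 2 / c * z k ^ 2 := by
      have h1 : 9 * K ^ 2 / c * z k ^ 2 = c * (3 * K * z k / c) ^ 2 := by field_simp; ring
      have h2 : ‖d‖ * (3 * K * br k * z k) = c * (br k * ‖d‖) * (3 * K * z k / c) := by
        field_simp
      rw [h1, h2]
      nlinarith [mul_nonneg hcpos.le (sq_nonneg (br k * ‖d‖ / 2 - 3 * K * z k / c))]
    rw [e2]
    linarith
  have hin := inner_eq_tsum_hat (f - g) (v - w)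
  have h1 : inner ℝ (f - g) (v - w) ≤ 9 * K ^ 2 / c * ∑' k, z k ^ 2 := by
    rw [← hin.tsum_eq, ← tsum_mul_left]
    exact hin.summable.tsum_le_tsum hmode (hz.mul_left _)
  have hnorm : ∑' n, ‖(a - b) n‖ ^ 2 = ‖f - g‖ ^ 2 := by
    rw [norm_sq_eq_tsum_hat, hat_sub]
  rw [hnorm] at hzle
  have h2 := hzle.trans (mul_le_mul_of_nonneg_right hUA (sq_nonneg ‖f - g‖))
  have h3 := mul_le_mul_of_nonneg_left h2 (show 0 ≤ 9 * K ^ 2 / c by positivity)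
  linarith

theorem IsStrongSolution.unique {ε δ β : ℝ} (hε : 0 < ε) (hδ : 0 < δ) (hβ : 0 ≤ β) {I : Set ℝ}
    (hI : ∀ t ∈ I, 0 ≤ t ∧ Set.Icc 0 t ⊆ I) {u₀ : L2C} {u w : ℝ → L2C}
    (hw : IsStrongSolution ε δ β I u₀ w) (hu : IsStrongSolution ε δ β I u₀ u) : Set.EqOn w u I := by
  -- The energy argument runs on the compact interval `[0,T]`, where both solutions are bounded in
  -- `H²`, and is read off at the final time.
  intro T hT
  obtain ⟨hT0, hsub⟩ := hI T hT
  replace hu := hu.mono hsub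
  replace hw := hw.mono hsub
  obtain ⟨A, hA⟩ := hu.exists_bound isCompact_Icc
  obtain ⟨B, hB⟩ := hw.exists_bound isCompact_Icc
  have hex : ∀ t, ∃ z : L2C, t ∈ Set.Icc 0 T → HasDerivWithinAt (fun t => w t - u t) z (Set.Icc 0 T) t
      ∧ 2 * inner ℝ (w t - u t) z ≤ 2 * (9 * bilConst δ β ^ 2 / (δ / (2 * ε))
        * (8 * (∑' k, 1 / wt k) * max A B)) * ‖w t - u t‖ ^ 2 := by
    intro t
    by_cases ht : t ∈ Set.Icc 0 T
    · obtain ⟨v, hv, hve⟩ := hu.equation t ht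
      obtain ⟨v', hv', hve'⟩ := hw.equation t ht
      refine ⟨v' - v, fun _ => ⟨hv'.sub hv, ?_⟩⟩
      have := energy_le hε hδ hβ (hw.isH2Seq ht) (hu.isH2Seq ht)
        ((hB t ht).trans (le_max_right A B)) ((hA t ht).trans (le_max_left A B)) hve' hve
      linarith
    · exact ⟨0, fun h => absurd h ht⟩
  choose z hz using hex
  have h := eq_zero_of_deriv_le_mul (E := fun t => ‖w t - u t‖ ^ 2)
    (E' := fun t => 2 * inner ℝ (w t - u t) (z t)) (fun t ht => (hz t ht).1.norm_sq)
    (fun t ht => (hz t ht).2) (by simp [hu.initial, hw.initial]) (fun t => sq_nonneg _) T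
    ⟨hT0, le_rfl⟩
  exact sub_eq_zero.mp (norm_eq_zero.mp (pow_eq_zero_iff two_ne_zero |>.mp h))

/-! ### The systems on bounded and unbounded time intervals -/

/-- The parabolic system of the equation on the time interval `I`, given a spectral gap `a` with
parabolic remainder `η` and a smoothing constant `κ`. -/
def waveSystem {ε δ β : ℝ} (hε : 0 < ε) (hδ : 0 < δ) (hβ : 0 ≤ β) {a η κ : ℝ} (ha : 0 ≤ a)
    (hη : 0 < η) (hκ : 0 ≤ κ) (hgap : ∀ k ≠ 0, a + η * wt k ≤ (linsym ε δ β k).re)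
    (I : Set ℝ) (p : ℝ → ℝ) (hp : Continuous p) (hpI : ∀ t, p t ∈ I) (hpe : ∀ t ∈ I, p t = t)
    (hI : ∀ t ∈ I, 0 ≤ t) (h0 : (0 : ℝ) ∈ I)
    (hker : ∀ k t, br k * ∫ s in (0 : ℝ)..p t, Real.exp (-(η * wt k * s)) ≤ κ) :
    ParabolicSystem where
  -- The true symbol vanishes at `k = 0` and violates the gap. Since the mean mode is identically
  -- zero, any value meeting the gap may replace it.
  μ k := if k = 0 then ((a + η : ℝ) : ℂ) else linsym ε δ β k
  S k n := -(1 / 2) * bilsym δ β k n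
  a := a
  η := η
  K := bilConst δ β
  L := (1 + δ) * (2 + β) / ε + (a + η)
  κ := κ
  I := I
  p := p
  a_nonneg := ha
  η_pos := hη
  K_nonneg := bilConst_nonneg hδ hβ
  κ_nonneg := hκ
  re_le k := by
    split_ifs with hk
    · subst hk; simp [wt]
    · exact hgap k hk
  norm_μ_le k := by
    have hw := one_le_wt k
    have h1 : 0 ≤ (1 + δ) * (2 + β) / ε := by positivity
    split_ifs with hk
    · rw [Complex.norm_of_nonneg (by positivity)]
      nlinarith
    · refine (norm_linsym_le hε hδ hβ k).trans ?_
      exact mul_le_mul_of_nonneg_right (by linarith) (by linarith)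
  norm_S_le k n := by
    refine le_trans ?_ (norm_bilsym_le hδ hβ k n)
    rw [norm_mul]
    refine mul_le_of_le_one_left (norm_nonneg _) ?_
    norm_num
  μ_neg k := by
    simp only [neg_eq_zero]
    split_ifs
    · rw [Complex.star_def, Complex.conj_ofReal]
    · exact linsym_neg ε δ β k
  S_neg k n := by rw [bilsym_neg, star_mul']; simp
  S_zero n := by simp [bilsym]
  p_cont := hp
  p_mem := hpI
  p_eq := hpe
  nonneg_of_mem := hI
  zero_mem := h0
  kernel_le := hker

theorem exists_strongSolution {ε δ β : ℝ} (hε : 0 < ε) (hδ : 0 < δ) (hβ : 0 ≤ β) {a η κ : ℝ}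
    (ha : 0 ≤ a) (hη : 0 < η) (hκ : 0 ≤ κ)
    (hgap : ∀ k ≠ 0, a + η * wt k ≤ (linsym ε δ β k).re)
    {I : Set ℝ} {p : ℝ → ℝ} (hp : Continuous p) (hpI : ∀ t, p t ∈ I) (hpe : ∀ t ∈ I, p t = t)
    (hI : ∀ t ∈ I, 0 ≤ t) (h0 : (0 : ℝ) ∈ I)
    (hker : ∀ k t, br k * ∫ s in (0 : ℝ)..p t, Real.exp (-(η * wt k * s)) ≤ κ)
    (hconv : Convex ℝ I) (hmeas : MeasurableSet I)
    (hint : ∫⁻ t in I, ENNReal.ofReal (Real.exp (-(2 * a * t))) < ∞)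
    {r : ℝ} (hr : 0 ≤ r)
    (hsmall : 4 * (4 * bilConst δ β * κ * ParabolicSystem.convConst) * r < 1) {u₀ : L2C}
    (hu₀ : RealZeroMean u₀) (hu₀r : sobolevNorm 2 u₀ ≤ ENNReal.ofReal r) :
    ∃ u : ℝ → L2C, IsStrongSolution ε δ β I u₀ u ∧
      (∀ w : ℝ → L2C, IsStrongSolution ε δ β I u₀ w → Set.EqOn w u I) ∧
      (∀ t, wienerNorm (u t)
        ≤ ENNReal.ofReal (ParabolicSystem.convConst * r * Real.exp (-(a * t)))) ∧
      ∀ s ≤ 2, ∀ t, sobolevNorm s (u t) ≤ ENNReal.ofReal (2 * r * Real.exp (-(a * t))) := by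
  set P := waveSystem hε hδ hβ ha hη hκ hgap I p hp hpI hpe hI h0 hker
  obtain ⟨hs, hle⟩ := tsum_le_of_sobolevNorm_le hr hu₀r
  obtain ⟨hz, hneg⟩ := (realZeroMean_iff u₀).mp hu₀
  obtain ⟨u, V, Q, h⟩ := P.exists_modeSolution hs hz hneg hr hle hsmall
  have hsol : IsStrongSolution ε δ β I u₀ h.toL2 :=
    h.isStrongSolution hε (fun k hk => if_neg hk) (fun k n => rfl) hconv hmeas hint hs
  refine ⟨h.toL2, hsol, fun w hw => ?_, h.wienerNorm_le hr, fun s hs t => h.sobolevNorm_le hr hs t⟩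
  exact IsStrongSolution.unique hε hδ hβ
    (fun t ht => ⟨hI t ht, hconv.ordConnected.out h0 ht⟩) hw hsol

/-! ### Kernel constants, local and global well-posedness. -/

lemma kernel_le_of_le {η T : ℝ} (hη : 0 < η) {t : ℝ} (ht : 0 ≤ t) (htT : t ≤ T) (k : ℤ) :
    br k * ∫ s in (0 : ℝ)..t, Real.exp (-(η * wt k * s)) ≤ √(2 * T / η) := by
  have hw := wt_pos k
  have hr : 0 < η * wt k := by positivity
  have h1 := ParabolicSystem.integral_exp_le hr t
  have h2 : ∫ s in (0 : ℝ)..t, Real.exp (-(η * wt k * s)) ≤ T := by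
    have h3 : ∫ s in (0 : ℝ)..t, Real.exp (-(η * wt k * s)) ≤ ∫ _ in (0 : ℝ)..t, (1 : ℝ) := by
      refine intervalIntegral.integral_mono_on ht (Continuous.intervalIntegrable (by fun_prop) _ _)
        (Continuous.intervalIntegrable (by fun_prop) _ _) fun s hs => ?_
      rw [Real.exp_le_one_iff]
      have := mul_nonneg hr.le hs.1
      linarith
    simp only [intervalIntegral.integral_const, smul_eq_mul, mul_one, sub_zero] at h3
    linarith
  have h0 : 0 ≤ ∫ s in (0 : ℝ)..t, Real.exp (-(η * wt k * s)) :=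
    intervalIntegral.integral_nonneg ht fun s _ => Real.exp_nonneg _
  -- The geometric mean of the bounds `T` and `1 / (η wt k)` gains exactly one derivative and still
  -- tends to zero with `T`.
  refine Real.le_sqrt_of_sq_le ?_
  set J := ∫ s in (0 : ℝ)..t, Real.exp (-(η * wt k * s))
  have hJ : J ^ 2 ≤ T * (1 / (η * wt k)) := by
    rw [sq]; exact mul_le_mul h2 h1 h0 (ht.trans htT)
  calc (br k * J) ^ 2 = br k ^ 2 * J ^ 2 := by ring
    _ ≤ (2 * wt k) * (T * (1 / (η * wt k))) :=
      mul_le_mul (br_sq_le k) hJ (sq_nonneg _) (by positivity)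
    _ = 2 * T / η := by field_simp

lemma kernel_le_const {η : ℝ} (hη : 0 < η) (t : ℝ) (k : ℤ) :
    br k * ∫ s in (0 : ℝ)..t, Real.exp (-(η * wt k * s)) ≤ 2 / η := by
  have hw := wt_pos k
  have h1 := ParabolicSystem.integral_exp_le (show 0 < η * wt k by positivity) t
  refine (mul_le_mul_of_nonneg_left h1 (br_pos k).le).trans ?_
  rw [mul_one_div, div_le_div_iff₀ (by positivity) hη]
  have := mul_le_mul_of_nonneg_right (br_le_wt k) hη.le
  linarith

theorem local_wellPosedness {ε δ β : ℝ} (hε : 0 < ε) (hδ : 0 < δ) (hβ : 0 ≤ β) (R : ℝ) :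
    ∃ T : ℝ, 0 < T ∧ ∀ u₀ : L2C, RealZeroMean u₀ → sobolevNorm 2 u₀ ≤ ENNReal.ofReal R →
      ∃ u : ℝ → L2C, IsStrongSolution ε δ β (Set.Icc 0 T) u₀ u ∧
        ∀ w : ℝ → L2C, IsStrongSolution ε δ β (Set.Icc 0 T) u₀ w → Set.EqOn w u (Set.Icc 0 T) := by
  -- Half of the viscous rate: `2ηk² ≥ η(1 + k²)` for `k ≠ 0`.
  set η := δ / (4 * ε) with hηdef
  have hη : 0 < η := by positivity
  set r := max R 0
  have hr : 0 ≤ r := le_max_right _ _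
  set M := 16 * bilConst δ β * ParabolicSystem.convConst * r
  have hM : 0 ≤ M := mul_nonneg (mul_nonneg (mul_nonneg (by norm_num) (bilConst_nonneg hδ hβ))
    ParabolicSystem.convConst_nonneg) hr
  -- Chosen so that `κ = 1 / (M + 1)`, which makes the contraction constant `M / (M + 1)`.
  set T := η / 2 * (1 / (M + 1)) ^ 2 with hT
  have hTpos : 0 < T := by positivity
  have hκ : √(2 * T / η) = 1 / (M + 1) := by
    rw [show 2 * T / η = (1 / (M + 1)) ^ 2 by rw [hT]; field_simp]
    exact Real.sqrt_sq (by positivity)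
  refine ⟨T, hTpos, fun u₀ hu₀ hR => ?_⟩
  have hmem : ∀ t, max 0 (min T t) ∈ Set.Icc 0 T := fun t =>
    ⟨le_max_left _ _, max_le hTpos.le (min_le_left _ _)⟩
  obtain ⟨u, hu, huniq, -⟩ := exists_strongSolution hε hδ hβ (a := 0) (η := η) (κ := √(2 * T / η))
    (I := Set.Icc 0 T) (p := fun t => max 0 (min T t)) (r := r) (u₀ := u₀) le_rfl hη
    (Real.sqrt_nonneg _) (fun k hk => by
      refine le_trans ?_ (le_re_linsym hε hδ hβ k)
      have hk1 : (1 : ℝ) ≤ (k : ℝ) ^ 2 := by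
        rw [← sq_abs]
        have : (1 : ℝ) ≤ |(k : ℝ)| := by exact_mod_cast Int.one_le_abs hk
        nlinarith
      have e : δ / (2 * ε) = 2 * η := by rw [hηdef]; field_simp; norm_num
      rw [e, wt]
      nlinarith)
    (by fun_prop) hmem (fun t ht => by rw [min_eq_right ht.2, max_eq_right ht.1])
    (fun t ht => ht.1) ⟨le_rfl, hTpos.le⟩
    (fun k t => kernel_le_of_le hη (hmem t).1 (hmem t).2 k) (convex_Icc 0 T) measurableSet_Icc
    (by simp) hr (by
      rw [hκ]
      have e : 4 * (4 * bilConst δ β * (1 / (M + 1)) * ParabolicSystem.convConst) * r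
          = M / (M + 1) := by
        simp only [M]; ring
      rw [e, div_lt_one (by positivity)]
      linarith) hu₀ (hR.trans (ENNReal.ofReal_le_ofReal (le_max_left _ _)))
  exact ⟨u, hu, huniq⟩

theorem global_wellPosedness {ε δ β : ℝ} (hε : 0 < ε) (hδ : 0 < δ) (hβ : 0 ≤ β) :
    ∃ c₀ : ℝ, 0 < c₀ ∧ ∀ u₀ : L2C, RealZeroMean u₀ → sobolevNorm 2 u₀ ≤ ENNReal.ofReal c₀ →
      ∃ u : ℝ → L2C, IsStrongSolution ε δ β (Set.Ici 0) u₀ u ∧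
        (∀ w : ℝ → L2C, IsStrongSolution ε δ β (Set.Ici 0) u₀ w → Set.EqOn w u (Set.Ici 0)) ∧
        (∀ t, wienerNorm (u t) ≤ ENNReal.ofReal (Real.exp (-(δ / (2 * ε) * t)))) ∧
        ∀ s ≤ 2, ∀ t, sobolevNorm s (u t) ≤ ENNReal.ofReal (Real.exp (-(δ / (2 * ε) * t))) := by
  set a := δ / (2 * ε)
  have ha : 0 < a := by positivity
  set η := a * (1 / (4 * (1 + δ ^ 2)))
  have hη : 0 < η := by positivity
  have hW := ParabolicSystem.convConst_nonneg
  set W := ParabolicSystem.convConst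
  set M := 16 * bilConst δ β * (2 / η) * W
  have hM : 0 ≤ M := mul_nonneg (mul_nonneg (mul_nonneg (by norm_num) (bilConst_nonneg hδ hβ))
    (by positivity)) hW
  have hden : 0 < M + W + 2 := by positivity
  -- `M` in the denominator ensures contraction, while `W` and `2` bring the prefactors of the
  -- Wiener and Sobolev estimates below `1`, so that `C` can be universal.
  refine ⟨1 / (M + W + 2), by positivity, fun u₀ hu₀ hR => ?_⟩
  obtain ⟨u, hu, huniq, hwiener, hsob⟩ := exists_strongSolution hε hδ hβ (a := a) (η := η)
    (κ := 2 / η) (I := Set.Ici 0) (p := fun t => max 0 t) (r := 1 / (M + W + 2)) (u₀ := u₀)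
    ha.le hη (by positivity) (fun k hk => gap_le_re_linsym hε hδ hβ hk) (by fun_prop)
    (fun t => Set.mem_Ici.mpr (le_max_left _ _)) (fun t ht => max_eq_right ht) (fun t ht => ht) Set.self_mem_Ici
    (fun k t => kernel_le_const hη _ k) (convex_Ici 0) measurableSet_Ici
    (by rw [lintegral_exp_neg_eq (by positivity)]; exact ENNReal.ofReal_lt_top)
    (by positivity) (by
      have e : 4 * (4 * bilConst δ β * (2 / η) * W) * (1 / (M + W + 2)) = M / (M + W + 2) := by
        simp only [M]; ring
      rw [e, div_lt_one hden]
      linarith) hu₀ hR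
  refine ⟨u, hu, huniq, fun t => (hwiener t).trans (ENNReal.ofReal_le_ofReal ?_),
    fun s hs t => (hsob s hs t).trans (ENNReal.ofReal_le_ofReal ?_)⟩
  · refine mul_le_of_le_one_left (Real.exp_nonneg _) ?_
    rw [mul_one_div, div_le_one hden]
    linarith
  · refine mul_le_of_le_one_left (Real.exp_nonneg _) ?_
    rw [mul_one_div, div_le_one hden]
    linarith

end ViscousWave

end

theorem theorem2 :
    ∃ (C : ℝ) (γ : ℝ → ℝ → ℝ), 0 < C ∧
      (∀ δ r : ℝ, 0 < δ → 0 ≤ r → r < 2 → 0 < γ δ r) ∧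
      ∀ ε δ β : ℝ, 0 < ε → 0 < δ → 0 ≤ β →
        -- local well-posedness, with an existence time depending only on the size of the datum
        (∀ R : ℝ, ∃ T : ℝ, 0 < T ∧
          ∀ u₀ : ViscousWave.L2C, ViscousWave.RealZeroMean u₀ →
            ViscousWave.sobolevNorm 2 u₀ ≤ ENNReal.ofReal R →
            ∃ u : ℝ → ViscousWave.L2C,
              ViscousWave.IsStrongSolution ε δ β (Set.Icc 0 T) u₀ u ∧
              ∀ w : ℝ → ViscousWave.L2C,
                ViscousWave.IsStrongSolution ε δ β (Set.Icc 0 T) u₀ w →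
                Set.EqOn w u (Set.Icc 0 T)) ∧
        -- global well-posedness and decay for small data
        (∃ c₀ : ℝ, 0 < c₀ ∧
          ∀ u₀ : ViscousWave.L2C, ViscousWave.RealZeroMean u₀ →
            ViscousWave.sobolevNorm 2 u₀ ≤ ENNReal.ofReal c₀ →
            ∃ u : ℝ → ViscousWave.L2C,
              ViscousWave.IsStrongSolution ε δ β (Set.Ici 0) u₀ u ∧
              (∀ w : ℝ → ViscousWave.L2C,
                ViscousWave.IsStrongSolution ε δ β (Set.Ici 0) u₀ w →
                Set.EqOn w u (Set.Ici 0)) ∧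
              (∀ t : ℝ, 0 ≤ t → ViscousWave.wienerNorm (u t) ≤
                ENNReal.ofReal (C * Real.exp (-(δ / (2 * ε)) * t))) ∧
              (∀ r : ℝ, 0 ≤ r → r < 2 → ∀ t : ℝ, 0 ≤ t →
                ViscousWave.sobolevNorm r (u t) ≤
                  ENNReal.ofReal (C * Real.exp (-(γ δ r / ε) * t)))) := by
  -- The weighted fixed point decays in `H²` itself, so the same rate `δ/2` serves every `r`.
  refine ⟨1, fun δ _ => δ / 2, one_pos, fun δ r hδ _ _ => by positivity,
    fun ε δ β hε hδ hβ => ⟨ViscousWave.local_wellPosedness hε hδ hβ, ?_⟩⟩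
  obtain ⟨c₀, hc₀, h⟩ := ViscousWave.global_wellPosedness hε hδ hβ
  refine ⟨c₀, hc₀, fun u₀ hu₀ hc => ?_⟩
  obtain ⟨u, hu, huniq, hwiener, hsob⟩ := h u₀ hu₀ hc
  refine ⟨u, hu, huniq, fun t _ => ?_, fun r _ hr t _ => ?_⟩
  · rw [one_mul, neg_mul]
    exact hwiener t
  · rw [one_mul, neg_mul, div_div]
    exact hsob r hr.le t
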